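/- Let $d\in\mathbb N$ and let $E$ be a translation-invariant Banach space of distributions on $\mathbb R^d$, that is, a Banach space (over $\mathbb R$ or $\mathbb C$) with dense continuous inclusions $\mathcal D(\mathbb R^d)\hookrightarrow E\hookrightarrow\mathcal D'(\mathbb R^d)$ such that $T_x(E)\subseteq E$ for all $x\in\mathbb R^d$, where $T_xf=f(\,\cdot\,+x)$ for $f\in\mathcal D'(\mathbb R^d)$. Let $\mathcal D_E$ be the space of all $e\in E$ such that $\partial^\alpha e\in E$ for all $\alpha\in\mathbb N^d$ (derivatives in the sense of distributions), endowed with the locally convex topology generated by the norms $$\|e\|_{E,n}=\max_{|\alpha|\le n}\|\partial^\alpha e\|_E,\qquad n\in\mathbb N.$$ Then $\mathcal D_E$ is a Fréchet space that satisfies condition $(\Omega)$: for every neighbourhood $U$ of $0$ in $\mathcal D_E$ there is a neighbourhood $V$ of $0$ such that for every neighbourhood $W$ of $0$ there are $C,s>0$ with $$V\subseteq \varepsilon U+\frac{C}{\varepsilon^s}W\qquad\text{for all }\varepsilon>0.$$ In particular, $\mathcal D_E$ is quasinormable (for every neighbourhood $U$ of $0$ there is a neighbourhood $V$ of $0$ such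 that for every $\varepsilon>0$ there is a bounded set $B$ with $V\subseteq\varepsilon U+B$) and distinguished (its strong dual is barrelled). -/

import Mathlib

open TopologicalSpace Filter
open scoped Distributions Topology Pointwise CompactConvergenceCLM

/-- The space `𝒟(ℝ^d)` of `𝕜`-valued test functions, with its canonical LF topology. -/
abbrev TestFn (d : ℕ) (𝕜 : Type*) [RCLike 𝕜] : Type _ :=
  𝓓((⊤ : Opens (EuclideanSpace ℝ (Fin d))), 𝕜)

/-- The space `𝒟'(ℝ^d)` of `𝕜`-valued distributions. Distributions are tested against real-valued
test functions; by `𝕜`-linear extension this is the dual of `TestFn d 𝕜`. -/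
abbrev Distr (d : ℕ) (𝕜 : Type*) [RCLike 𝕜] : Type _ :=
  𝓓'((⊤ : Opens (EuclideanSpace ℝ (Fin d))), 𝕜)

/-- The test function `y ↦ φ (y - x)`. -/
noncomputable def TestFn.shift {d : ℕ} (x : EuclideanSpace ℝ (Fin d)) (φ : TestFn d ℝ) :
    TestFn d ℝ where
  toFun y := φ (y - x)
  contDiff' := φ.contDiff.comp (contDiff_id.sub contDiff_const)
  hasCompactSupport' := φ.hasCompactSupport.comp_homeomorph (Homeomorph.subRight x)
  tsupport_subset' := fun _ _ => trivial

/-- The map `φ ↦ φ (· - x)` as a continuous linear map on test functions. -/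
noncomputable def TestFn.shiftCLM {d : ℕ} (x : EuclideanSpace ℝ (Fin d)) :
    TestFn d ℝ →L[ℝ] TestFn d ℝ :=
  TestFunction.limitCLM ℝ (TestFn.shift x)
    (fun K _ =>
      (TestFunction.ofSupportedInCLM ℝ (Ω := ⊤)
        (K := ⟨(Homeomorph.subRight x) ⁻¹' (K : Set (EuclideanSpace ℝ (Fin d))),
          (Homeomorph.subRight x).isCompact_preimage.2 K.isCompact⟩) (fun _ _ => trivial)).comp
      (ContDiffMapSupportedIn.mkCLM ℝ (fun φ y => φ (y - x))
        (fun _ _ _ => rfl) (fun _ _ _ => rfl)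
        (fun φ => φ.contDiff.comp (contDiff_id.sub contDiff_const))
        (fun φ y hy => φ.zero_on_compl hy)
        (fun i _ => ⟨{i}, 1, zero_le_one, fun φ y _ => by
          rw [iteratedFDeriv_comp_sub, one_mul, Finset.sup_singleton]
          exact ContDiffMapSupportedIn.norm_iteratedFDeriv_apply_le_seminorm_top ℝ⟩)))
    (fun _ _ _ => rfl)

/-- Translation of distributions, `T_x f = f (· + x)`, i.e. `⟨T_x f, φ⟩ = ⟨f, φ (· - x)⟩`. -/
noncomputable def Distr.translate {d : ℕ} {𝕜 : Type*} [RCLike 𝕜]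
    (x : EuclideanSpace ℝ (Fin d)) : Distr d 𝕜 →L[ℝ] Distr d 𝕜 :=
  (TestFn.shiftCLM x).precompCompactConvergenceCLM _

theorem Distr.translate_apply {d : ℕ} {𝕜 : Type*} [RCLike 𝕜]
    (x : EuclideanSpace ℝ (Fin d)) (f : Distr d 𝕜) (φ : TestFn d ℝ) :
    Distr.translate x f φ = f (TestFn.shift x φ) := rfl

/-- The distributional derivative `∂^α = ∂_1^{α_1} ⋯ ∂_d^{α_d}`. -/
noncomputable def Distr.partialDeriv {d : ℕ} {𝕜 : Type*} [RCLike 𝕜] (α : Fin d → ℕ) :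
    Distr d 𝕜 →L[ℝ] Distr d 𝕜 :=
  ((List.finRange d).map fun i =>
    (Distribution.lineDerivCLM (EuclideanSpace.single i (1 : ℝ)) :
      Distr d 𝕜 →L[ℝ] Distr d 𝕜) ^ α i).prod

theorem Distr.partialDeriv_smul {d : ℕ} {𝕜 : Type*} [RCLike 𝕜] (α : Fin d → ℕ) (c : 𝕜)
    (f : Distr d 𝕜) :
    Distr.partialDeriv α (c • f) = c • Distr.partialDeriv α f := by
  have key : ∀ (i : Fin d) (n : ℕ) (g : Distr d 𝕜),
      ((Distribution.lineDerivCLM (EuclideanSpace.single i (1 : ℝ)) :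
        Distr d 𝕜 →L[ℝ] Distr d 𝕜) ^ n) (c • g) =
      c • ((Distribution.lineDerivCLM (EuclideanSpace.single i (1 : ℝ)) :
        Distr d 𝕜 →L[ℝ] Distr d 𝕜) ^ n) g := by
    intro i n g
    induction n with
    | zero => rfl
    | succ n ih =>
      rw [pow_succ', mul_apply_eq_comp, ih, mul_apply_eq_comp]
      ext φ
      exact (smul_neg c (_ : 𝕜)).symm
  unfold Distr.partialDeriv
  induction List.finRange d with
  | nil => rfl
  | cons i l ih =>
    rw [List.map_cons, List.prod_cons, mul_apply_eq_comp, ih, mul_apply_eq_comp, key]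

/-- A translation-invariant Banach space of distributions: a Banach space `E` with dense continuous
inclusions `𝒟(ℝ^d) ↪ E ↪ 𝒟'(ℝ^d)` such that `T_x (E) ⊆ E` for all `x`. -/
structure TIBD (d : ℕ) (𝕜 : Type*) [RCLike 𝕜] (E : Type*) [NormedAddCommGroup E]
    [NormedSpace 𝕜 E] [CompleteSpace E] where
  /-- the inclusion `E ⊆ 𝒟'(ℝ^d)` -/
  toDistr : E →L[𝕜] Distr d 𝕜
  injective_toDistr : Function.Injective toDistr
  denseRange_toDistr : DenseRange toDistr
  /-- the inclusion `𝒟(ℝ^d) ⊆ E` -/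
  ofTestFn : TestFn d 𝕜 →L[𝕜] E
  /-- the composite `𝒟(ℝ^d) → E → 𝒟'(ℝ^d)` is the usual inclusion of functions in distributions -/
  toDistr_ofTestFn : ∀ (φ : TestFn d 𝕜) (ψ : TestFn d ℝ),
    toDistr (ofTestFn φ) ψ = ∫ x, ψ x • φ x
  denseRange_ofTestFn : DenseRange ofTestFn
  translate_mem : ∀ (x : EuclideanSpace ℝ (Fin d)) (e : E),
    Distr.translate x (toDistr e) ∈ Set.range toDistr

namespace TIBD

variable {d : ℕ} {𝕜 : Type*} [RCLike 𝕜] {E : Type*} [NormedAddCommGroup E]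
  [NormedSpace 𝕜 E] [CompleteSpace E]

/-- The elements of `E` all of whose distributional derivatives belong to `E`. -/
def smoothSubmodule (h : TIBD d 𝕜 E) : Submodule 𝕜 E where
  carrier := {e | ∀ α : Fin d → ℕ, Distr.partialDeriv α (h.toDistr e) ∈ Set.range h.toDistr}
  zero_mem' α := ⟨0, by simp⟩
  add_mem' := by
    intro a b ha hb α
    obtain ⟨a', ha'⟩ := ha α
    obtain ⟨b', hb'⟩ := hb α
    exact ⟨a' + b', by simp [ha', hb']⟩
  smul_mem' := by
    intro c a ha α
    obtain ⟨a', ha'⟩ := ha α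
    exact ⟨c • a', by rw [map_smul, ha', map_smul, Distr.partialDeriv_smul]⟩

/-- The space `𝒟_E`. It is a type of its own, since its topology is not the one inherited
from `E`. -/
def DE (h : TIBD d 𝕜 E) : Type _ := h.smoothSubmodule

noncomputable instance (h : TIBD d 𝕜 E) : AddCommGroup h.DE :=
  inferInstanceAs (AddCommGroup h.smoothSubmodule)

noncomputable instance (h : TIBD d 𝕜 E) : Module 𝕜 h.DE :=
  inferInstanceAs (Module 𝕜 h.smoothSubmodule)

/-- The inclusion `𝒟_E ⊆ E`. -/
def incl (h : TIBD d 𝕜 E) : h.DE →ₗ[𝕜] E := h.smoothSubmodule.subtype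

theorem exists_deriv (h : TIBD d 𝕜 E) (α : Fin d → ℕ) (e : h.DE) :
    ∃ e' : E, h.toDistr e' = Distr.partialDeriv α (h.toDistr (h.incl e)) :=
  Subtype.property (p := fun e => e ∈ h.smoothSubmodule) e α

/-- The derivative `∂^α e`, for `e ∈ 𝒟_E`, as an element of `E`. -/
noncomputable def derivFun (h : TIBD d 𝕜 E) (α : Fin d → ℕ) (e : h.DE) : E :=
  (h.exists_deriv α e).choose

theorem toDistr_derivFun (h : TIBD d 𝕜 E) (α : Fin d → ℕ) (e : h.DE) :
    h.toDistr (h.derivFun α e) = Distr.partialDeriv α (h.toDistr (h.incl e)) :=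
  (h.exists_deriv α e).choose_spec

/-- The map `∂^α : 𝒟_E → E`, which is linear. -/
noncomputable def deriv (h : TIBD d 𝕜 E) (α : Fin d → ℕ) : h.DE →ₗ[𝕜] E where
  toFun := h.derivFun α
  map_add' a b := h.injective_toDistr (by
    simp only [map_add, toDistr_derivFun])
  map_smul' c a := h.injective_toDistr (by
    simp only [RingHom.id_apply, map_smul, toDistr_derivFun, Distr.partialDeriv_smul])

/-- The norms `‖e‖_{E,n} = max_{|α| ≤ n} ‖∂^α e‖_E` on `𝒟_E`. -/
noncomputable def norms (h : TIBD d 𝕜 E) : SeminormFamily 𝕜 h.DE ℕ := fun n =>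
  ((Finset.Iic fun _ : Fin d => n).filter fun α => ∑ i, α i ≤ n).sup fun α =>
    (normSeminorm 𝕜 E).comp (h.deriv α)

noncomputable instance (h : TIBD d 𝕜 E) : TopologicalSpace h.DE :=
  h.norms.moduleFilterBasis.topology

theorem withSeminorms_norms (h : TIBD d 𝕜 E) : WithSeminorms h.norms := ⟨rfl⟩

instance (h : TIBD d 𝕜 E) : IsTopologicalAddGroup h.DE :=
  h.withSeminorms_norms.topologicalAddGroup

instance (h : TIBD d 𝕜 E) : ContinuousSMul 𝕜 h.DE :=
  h.withSeminorms_norms.continuousSMul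

end TIBD

/-- A Fréchet space: Hausdorff, with topology given by countably many seminorms, and complete. -/
def IsFrechetSpace (𝕜 F : Type*) [RCLike 𝕜] [AddCommGroup F] [Module 𝕜 F]
    [TopologicalSpace F] : Prop :=
  T2Space F ∧ (∃ p : SeminormFamily 𝕜 F ℕ, WithSeminorms p) ∧
    ∀ u : ℕ → F, Tendsto (fun k : ℕ × ℕ => u k.1 - u k.2) atTop (𝓝 0) →
      ∃ x, Tendsto u atTop (𝓝 x)

/-- The condition `(Ω)`. -/
def SatisfiesOmega (𝕜 F : Type*) [RCLike 𝕜] [AddCommGroup F] [Module 𝕜 F]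
    [TopologicalSpace F] : Prop :=
  ∀ U ∈ 𝓝 (0 : F), ∃ V ∈ 𝓝 (0 : F), ∀ W ∈ 𝓝 (0 : F), ∃ C > (0 : ℝ), ∃ s > (0 : ℝ),
    ∀ ε > (0 : ℝ), V ⊆ (ε : 𝕜) • U + ((C / ε ^ s : ℝ) : 𝕜) • W

/-- Quasinormable spaces. -/
def IsQuasinormable (𝕜 F : Type*) [RCLike 𝕜] [AddCommGroup F] [Module 𝕜 F]
    [TopologicalSpace F] : Prop :=
  ∀ U ∈ 𝓝 (0 : F), ∃ V ∈ 𝓝 (0 : F), ∀ ε > (0 : ℝ), ∃ B : Set F,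
    Bornology.IsVonNBounded 𝕜 B ∧ V ⊆ (ε : 𝕜) • U + B

/-- A space is distinguished if its strong dual (the dual with the topology of uniform convergence
on bounded sets) is barrelled. -/
def IsDistinguished (𝕜 F : Type*) [RCLike 𝕜] [AddCommGroup F] [Module 𝕜 F]
    [TopologicalSpace F] [IsTopologicalAddGroup F] [ContinuousSMul 𝕜 F] : Prop :=
  BarrelledSpace 𝕜 (F →L[𝕜] 𝕜)

/-! ### Condition (Ω) and quasinormability from approximation in graded seminorms -/

section GradedSeminorms

variable {𝕜 F : Type*} [RCLike 𝕜] [AddCommGroup F] [Module 𝕜 F]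

/-! The translations `T_x` are bounded on `E` by the closed graph theorem. They form a strongly
continuous group: Baire's theorem bounds them near `0`, and the orbits of the dense test functions
are continuous. For a coordinate vector `v` the average `S e = δ⁻¹ ∫₀^δ T_{sv} e ds` commutes with
every `∂^α` and satisfies `‖S e - e‖ ≤ M δ ‖∂_v e‖`. Since `S ∂_v e = δ⁻¹ (T_{δv} e - e)`, it also
absorbs one derivative at the cost of a factor `(M + 1)/δ` (`TIBD.exists_average`). Averaging at
least `k` times in each coordinate direction, `l` times in all, turns `x` into `y` with `‖x - y‖_n =
O(δ) ‖x‖_{n+1}` and `‖y‖_k = O(δ^{-l}) ‖x‖_{n+1}` (`TIBD.exists_approx`). Taking `δ` proportional to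
`ε` gives (Ω).

For quasinormability the approximation is repeated at the levels `n, n+1, ...` with summable errors;
by completeness the approximants converge to some `b`, all of whose seminorms are bounded
independently of `x` (`exists_bounded_approx_of_approx`).

For distinguishedness, let `q` be a lower semicontinuous seminorm on the strong dual. It is bounded
on the polars of seminorm balls, because these are balls of Banach duals. Quasinormability then
yields boxes (sets with prescribed bounds on all seminorms) such that `q ≤ 2^{-(n+1)}` on
functionals bounded by `2` on the `2^{-n}`-ball of `p n` and on the `n`-th box
(`exists_boxes_of_bounded_approx`). The intersection of slightly enlarged sums "ball + box" is
bounded, and Hahn-Banach splits each functional in its polar into finitely many such pieces, so `q ≤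
1` there. -/

theorem Seminorm.mem_smul_ball_zero_of_lt (p : Seminorm 𝕜 F) {c r : ℝ} (hc : 0 < c) {x : F}
    (hx : p x < c * r) : x ∈ (c : 𝕜) • p.ball 0 r := by
  have hc' : (c : 𝕜) ≠ 0 := RCLike.ofReal_ne_zero.2 hc.ne'
  rw [Set.mem_smul_set_iff_inv_smul_mem₀ hc', p.mem_ball_zero, map_smul_eq_mul, norm_inv,
    RCLike.norm_ofReal, abs_of_pos hc, inv_mul_lt_iff₀ hc]
  exact hx

variable [TopologicalSpace F] {p : SeminormFamily 𝕜 F ℕ}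

theorem WithSeminorms.exists_ball_subset_of_monotone (hp : WithSeminorms p) (hmono : Monotone p)
    {U : Set F} (hU : U ∈ 𝓝 (0 : F)) : ∃ n, ∃ r > (0 : ℝ), (p n).ball 0 r ⊆ U := by
  obtain ⟨s, r, hr, h⟩ := (hp.mem_nhds_iff 0 U).1 hU
  refine ⟨s.sup id, r, hr, fun x hx => h ?_⟩
  rw [Seminorm.mem_ball_zero] at hx ⊢
  refine lt_of_le_of_lt ?_ hx
  have : s.sup p ≤ p (s.sup id) := Finset.sup_le fun i hi => hmono (Finset.le_sup (f := id) hi)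
  exact this x

theorem WithSeminorms.ball_zero_mem_nhds (hp : WithSeminorms p) (n : ℕ) {r : ℝ} (hr : 0 < r) :
    (p n).ball 0 r ∈ 𝓝 (0 : F) :=
  (hp.mem_nhds_iff 0 _).2 ⟨{n}, r, hr, by simp⟩

/-- Every vector is approximated, with polynomial control of all the higher seminorms. -/
theorem satisfiesOmega_of_approx (hp : WithSeminorms p) (hmono : Monotone p)
    (H : ∀ n k, ∃ C > (0 : ℝ), ∃ s > (0 : ℝ), ∀ ε > (0 : ℝ), ε ≤ 1 → ∀ x, ∃ y,
      p n (x - y) ≤ ε * p (n + 1) x ∧ p k y ≤ C / ε ^ s * p (n + 1) x) :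
    SatisfiesOmega 𝕜 F := by
  intro U hU
  obtain ⟨n, r, hr, hrU⟩ := hp.exists_ball_subset_of_monotone hmono hU
  refine ⟨(p (n + 1)).ball 0 r, hp.ball_zero_mem_nhds _ hr, fun W hW => ?_⟩
  obtain ⟨k, w, hw, hwW⟩ := hp.exists_ball_subset_of_monotone hmono hW
  obtain ⟨C, hC, s, hs, h⟩ := H n k
  refine ⟨C * r / w, by positivity, s, hs, fun ε hε x hx => ?_⟩
  rw [Seminorm.mem_ball_zero] at hx
  have hεs : 0 < ε ^ s := Real.rpow_pos_of_pos hε s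
  -- For `ε > 1` the choice `y = 0` suffices, as `p n ≤ p (n + 1)`.
  have key : ∃ y, p n (x - y) < ε * r ∧ p k y < C / ε ^ s * r := by
    rcases le_or_gt ε 1 with h1 | h1
    · obtain ⟨y, hy, hy'⟩ := h ε hε h1 x
      exact ⟨y, hy.trans_lt (by gcongr), hy'.trans_lt (by gcongr)⟩
    · refine ⟨0, ?_, ?_⟩
      · rw [sub_zero]
        calc p n x ≤ p (n + 1) x := hmono n.le_succ x
          _ < r := hx
          _ ≤ ε * r := le_mul_of_one_le_left hr.le h1.le
      · rw [map_zero]; positivity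
  obtain ⟨y, hy, hy'⟩ := key
  refine Set.mem_add.2 ⟨x - y, Set.smul_set_mono hrU ((p n).mem_smul_ball_zero_of_lt hε hy), y,
    Set.smul_set_mono hwW ((p k).mem_smul_ball_zero_of_lt (by positivity) ?_), sub_add_cancel _ _⟩
  convert hy' using 1
  field_simp

/-- Successive approximation: in a sequentially complete space the approximants can be chosen in
one set on which all the seminorms are bounded. -/
theorem exists_bounded_approx_of_approx (hp : WithSeminorms p) (hmono : Monotone p)
    (hcomplete : ∀ u : ℕ → F, Tendsto (fun k : ℕ × ℕ => u k.1 - u k.2) atTop (𝓝 0) →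
      ∃ x, Tendsto u atTop (𝓝 x))
    (H : ∀ n k, ∀ ε > (0 : ℝ), ∃ C > (0 : ℝ), ∀ x, ∃ y,
      p n (x - y) ≤ ε * p (n + 1) x ∧ p k y ≤ C * p (n + 1) x)
    (n : ℕ) {ε : ℝ} (hε : 0 < ε) :
    ∃ C : ℕ → ℝ, ∀ x, p (n + 1) x ≤ 1 → ∃ b, p n (x - b) ≤ ε ∧ ∀ k, p k b ≤ C k := by
  choose! K hK y hy hy' using H
  -- `D j` will bound `p (n + j + 1)` of the `j`-th approximant. The relative accuracy `η j (D j)`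
  -- makes the `j`-th error at most `ε / 2^(j+1)`. Neither depends on `x`, so the final bounds are
  -- uniform.
  let η : ℕ → ℝ → ℝ := fun j D => ε * (1 / 2) ^ (j + 1) / D
  let D : ℕ → ℝ := fun j => Nat.rec 1 (fun j D => K (n + j) (n + j + 2) (η j D) * D) j
  have hD0 : D 0 = 1 := rfl
  have hDs : ∀ j, D (j + 1) = K (n + j) (n + j + 2) (η j (D j)) * D j := fun j => rfl
  have hη : ∀ j {D : ℝ}, 0 < D → 0 < η j D := fun j D hD => by positivity
  have hDpos : ∀ j, 0 < D j := by
    intro j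
    induction j with
    | zero => rw [hD0]; exact one_pos
    | succ j ih => rw [hDs]; exact mul_pos (hK _ _ _ (hη j ih)) ih
  refine ⟨fun k => D k + ε, fun x hx => ?_⟩
  -- Each step raises the level by one: the error is measured in `p (n + j)`, and the new vector is
  -- controlled in `p (n + j + 2)`, the norm needed for the next step.
  let u : ℕ → F := fun j => Nat.rec x (fun j z => y (n + j) (n + j + 2) (η j (D j)) z) j
  have hu0 : u 0 = x := rfl
  have hus : ∀ j, u (j + 1) = y (n + j) (n + j + 2) (η j (D j)) (u j) := fun j => rfl
  have huD : ∀ j, p (n + j + 1) (u j) ≤ D j := by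
    intro j
    induction j with
    | zero => simpa [hu0, hD0] using hx
    | succ j ih =>
      rw [hus, hDs]
      refine (hy' (n + j) (n + j + 2) _ (hη j (hDpos j)) (u j)).trans ?_
      exact mul_le_mul_of_nonneg_left ih (hK _ _ _ (hη j (hDpos j))).le
  have hstep : ∀ j, p (n + j) (u j - u (j + 1)) ≤ ε * (1 / 2) ^ (j + 1) := by
    intro j
    rw [hus]
    refine (hy (n + j) (n + j + 2) _ (hη j (hDpos j)) (u j)).trans ?_
    calc η j (D j) * p (n + j + 1) (u j) ≤ η j (D j) * D j :=
          mul_le_mul_of_nonneg_left (huD j) (hη j (hDpos j)).le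
      _ = ε * (1 / 2) ^ (j + 1) := div_mul_cancel₀ _ (hDpos j).ne'
  have htele : ∀ J l, p (n + J) (u J - u (J + l)) ≤ ε * ((1 / 2) ^ J - (1 / 2) ^ (J + l)) := by
    intro J l
    induction l with
    | zero => simp
    | succ l ih =>
      have h1 : u J - u (J + (l + 1)) = (u J - u (J + l)) + (u (J + l) - u (J + l + 1)) := by
        rw [sub_add_sub_cancel]; rfl
      have h2 : p (n + J) (u (J + l) - u (J + l + 1)) ≤ ε * (1 / 2) ^ (J + l + 1) :=
        (hmono (by omega : n + J ≤ n + (J + l)) _).trans (hstep (J + l))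
      rw [h1]
      refine (map_add_le_add _ _ _).trans ((add_le_add ih h2).trans (le_of_eq ?_))
      rw [← add_assoc J l 1, pow_succ]
      ring
  have htail : ∀ J i, J ≤ i → p (n + J) (u J - u i) ≤ ε * (1 / 2) ^ J := by
    intro J i hi
    obtain ⟨l, rfl⟩ := Nat.exists_eq_add_of_le hi
    refine (htele J l).trans (mul_le_mul_of_nonneg_left (sub_le_self _ (by positivity)) hε.le)
  obtain ⟨b, hb⟩ := hcomplete u <| by
    rw [hp.tendsto_nhds]
    intro i δ hδ
    have hlim : Tendsto (fun J : ℕ => ε * (1 / 2 : ℝ) ^ J + ε * (1 / 2) ^ J) atTop (𝓝 0) := by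
      have := (tendsto_pow_atTop_nhds_zero_of_lt_one (r := (1 / 2 : ℝ)) (by norm_num)
        (by norm_num)).const_mul ε
      simpa using this.add this
    obtain ⟨J, hJ, hiJ⟩ := ((hlim.eventually_lt_const hδ).and (eventually_ge_atTop i)).exists
    filter_upwards [eventually_ge_atTop (J, J)] with k hk
    have h3 : u k.1 - u k.2 - 0 = (u J - u k.2) - (u J - u k.1) := by abel
    rw [h3]
    calc p i ((u J - u k.2) - (u J - u k.1)) ≤ p (n + J) ((u J - u k.2) - (u J - u k.1)) :=
          hmono (by omega) _
      _ ≤ p (n + J) (u J - u k.2) + p (n + J) (u J - u k.1) := map_sub_le_add _ _ _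
      _ ≤ _ := add_le_add (htail J _ hk.2) (htail J _ hk.1)
      _ < δ := hJ
  have hblim : ∀ J, p (n + J) (u J - b) ≤ ε * (1 / 2) ^ J := by
    intro J
    have h4 : Tendsto (fun i => p (n + J) (u i - b)) atTop (𝓝 0) := by
      rw [hp.tendsto_nhds] at hb
      rw [Metric.tendsto_nhds]
      intro δ hδ
      filter_upwards [hb (n + J) δ hδ] with i hi
      simpa [Real.dist_eq, abs_of_nonneg (apply_nonneg (p (n + J)) _)] using hi
    refine ge_of_tendsto (f := fun i => ε * (1 / 2) ^ J + p (n + J) (u i - b))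
      (by simpa using h4.const_add (ε * (1 / 2) ^ J)) ?_
    filter_upwards [eventually_ge_atTop J] with i hi
    rw [← sub_add_sub_cancel (u J) (u i) b]
    exact (map_add_le_add _ _ _).trans (add_le_add (htail J i hi) le_rfl)
  refine ⟨b, by simpa [hu0] using hblim 0, fun k => ?_⟩
  have h5 : b = u k - (u k - b) := by abel
  calc p k b = p k (u k - (u k - b)) := by rw [← h5]
    _ ≤ p k (u k) + p k (u k - b) := map_sub_le_add _ _ _
    _ ≤ p (n + k + 1) (u k) + p (n + k) (u k - b) :=
        add_le_add (hmono (by omega) _) (hmono (by omega) _)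
    _ ≤ D k + ε * (1 / 2) ^ k := add_le_add (huD k) (hblim k)
    _ ≤ D k + ε := by
        gcongr
        exact mul_le_of_le_one_right hε.le (pow_le_one₀ (by norm_num) (by norm_num))

theorem WithSeminorms.isVonNBounded_of_forall_le (hp : WithSeminorms p) {B : Set F} (C : ℕ → ℝ)
    (hB : ∀ b ∈ B, ∀ k, p k b ≤ C k) : Bornology.IsVonNBounded 𝕜 B := by
  rw [hp.isVonNBounded_iff_seminorm_bounded]
  exact fun i => ⟨|C i| + 1, by positivity, fun x hx =>
    (hB x hx i).trans_lt ((le_abs_self _).trans_lt (lt_add_one _))⟩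

theorem isQuasinormable_of_bounded_approx (hp : WithSeminorms p) (hmono : Monotone p)
    (Q : ∀ n, ∀ ε > (0 : ℝ), ∃ C : ℕ → ℝ, ∀ x, p (n + 1) x ≤ 1 →
      ∃ b, p n (x - b) ≤ ε ∧ ∀ k, p k b ≤ C k) :
    IsQuasinormable 𝕜 F := by
  intro U hU
  obtain ⟨n, r, hr, hrU⟩ := hp.exists_ball_subset_of_monotone hmono hU
  refine ⟨(p (n + 1)).ball 0 1, hp.ball_zero_mem_nhds _ one_pos, fun ε hε => ?_⟩
  obtain ⟨C, hC⟩ := Q n (ε * r / 2) (by positivity)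
  refine ⟨{b | ∀ k, p k b ≤ C k}, hp.isVonNBounded_of_forall_le C fun b hb => hb, fun x hx => ?_⟩
  rw [Seminorm.mem_ball_zero] at hx
  obtain ⟨b, hb, hb'⟩ := hC x hx.le
  refine Set.mem_add.2 ⟨x - b, Set.smul_set_mono hrU ((p n).mem_smul_ball_zero_of_lt hε ?_), b, hb',
    sub_add_cancel _ _⟩
  exact hb.trans_lt (half_lt_self (by positivity))

end GradedSeminorms

/-! ### Splitting linear forms by the Hahn-Banach theorem -/

section HahnBanachDecomposition

variable {𝕜 F : Type*} [RCLike 𝕜] [AddCommGroup F] [Module 𝕜 F]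

/-- A linear form dominated by a sum of two seminorms splits accordingly. -/
theorem Module.Dual.exists_add_of_le_seminorm_add (f : Module.Dual 𝕜 F) (p r : Seminorm 𝕜 F)
    (hf : ∀ x, ‖f x‖ ≤ p x + r x) :
    ∃ g h : Module.Dual 𝕜 F, f = g + h ∧ (∀ x, ‖g x‖ ≤ p x) ∧ ∀ x, ‖h x‖ ≤ r x := by
  -- On the diagonal of `F × F` the form `(x, x) ↦ f x` is dominated by `p ⊕ r`. An extension
  -- dominated by `p ⊕ r`, restricted to the two factors, gives the summands.
  let P : Seminorm 𝕜 (F × F) := p.comp (LinearMap.fst 𝕜 F F) + r.comp (LinearMap.snd 𝕜 F F)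
  have hP : ∀ z, P z = p z.1 + r z.2 := fun z => rfl
  let S : Submodule 𝕜 (F × F) := LinearMap.range (LinearMap.id.prod LinearMap.id)
  let φ : Module.Dual 𝕜 S := (f ∘ₗ LinearMap.fst 𝕜 F F) ∘ₗ S.subtype
  obtain ⟨G, hG, hGP⟩ := Module.Dual.exists_extension_of_le_seminorm S φ (p := P) (by
    rintro ⟨_, x, rfl⟩
    exact hf x)
  refine ⟨G ∘ₗ LinearMap.inl 𝕜 F F, G ∘ₗ LinearMap.inr 𝕜 F F, ?_, fun x => ?_, fun x => ?_⟩
  · ext x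
    have h1 : G (x, x) = f x := hG ⟨(x, x), x, rfl⟩
    have h2 : (x, x) = (x, (0 : F)) + ((0 : F), x) := by simp
    rw [← h1, h2, map_add]
    rfl
  · simpa [hP] using hGP (x, 0)
  · simpa [hP] using hGP (0, x)

theorem Module.Dual.exists_sum_of_le_seminorm_sum {ι : Type*} (s : Finset ι)
    (r : ι → Seminorm 𝕜 F) (f : Module.Dual 𝕜 F) (hf : ∀ x, ‖f x‖ ≤ ∑ i ∈ s, r i x) :
    ∃ g : ι → Module.Dual 𝕜 F, f = ∑ i ∈ s, g i ∧ ∀ i ∈ s, ∀ x, ‖g i x‖ ≤ r i x := by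
  classical
  induction s using Finset.induction_on generalizing f with
  | empty =>
    refine ⟨fun _ => 0, ?_, by simp⟩
    ext x
    simpa using hf x
  | insert a s ha ih =>
    have hsum : ∀ x, (∑ i ∈ s, r i) x = ∑ i ∈ s, r i x := fun x => by
      rw [← FunLike.coeAddMonoidHom_apply, map_sum, Finset.sum_apply]
      rfl
    obtain ⟨g, h, rfl, hg, hh⟩ := f.exists_add_of_le_seminorm_add (r a) (∑ i ∈ s, r i)
      (fun x => by
        have := hf x
        rw [Finset.sum_insert ha] at this
        rwa [hsum])
    obtain ⟨g', rfl, hg'⟩ := ih h (fun x => by rw [← hsum]; exact hh x)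
    refine ⟨Function.update g' a g, ?_, ?_⟩
    · rw [Finset.sum_insert ha, Function.update_self]
      congr 1
      refine Finset.sum_congr rfl fun i hi => ?_
      rw [Function.update_of_ne (by rintro rfl; exact ha hi)]
    · intro i hi x
      rcases Finset.mem_insert.1 hi with rfl | hi'
      · rw [Function.update_self]; exact hg x
      · rw [Function.update_of_ne (by rintro rfl; exact ha hi')]; exact hg' i hi' x

end HahnBanachDecomposition

/-! ### Sums of a seminorm ball and a box -/

section BallAddBox

variable {𝕜 F : Type*} [RCLike 𝕜] [AddCommGroup F] [Module 𝕜 F] {p : SeminormFamily 𝕜 F ℕ}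

/-- The sum of a seminorm ball and a box, the set of vectors with prescribed bounds on all
seminorms. -/
def ballAddBox (p : SeminormFamily 𝕜 F ℕ) (n : ℕ) (ρ : ℝ) (C : ℕ → ℝ) : Set F :=
  {x | ∃ b, p n (x - b) ≤ ρ ∧ ∀ k, p k b ≤ C k}

theorem balanced_ballAddBox (n : ℕ) (ρ : ℝ) (C : ℕ → ℝ) :
    Balanced 𝕜 (ballAddBox p n ρ C) := by
  rintro a ha _ ⟨x, ⟨b, hb, hb'⟩, rfl⟩
  refine ⟨a • b, ?_, fun k => ?_⟩
  · simp only [← smul_sub, map_smul_eq_mul]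
    exact (mul_le_of_le_one_left (apply_nonneg _ _) ha).trans hb
  · rw [map_smul_eq_mul]
    exact (mul_le_of_le_one_left (apply_nonneg _ _) ha).trans (hb' k)

theorem convex_ballAddBox [Module ℝ F] [IsScalarTower ℝ 𝕜 F] (n : ℕ) (ρ : ℝ) (C : ℕ → ℝ) :
    Convex ℝ (ballAddBox p n ρ C) := by
  have hle : ∀ (k : ℕ) {s t : ℝ} (x y : F), 0 ≤ s → 0 ≤ t →
      p k (s • x + t • y) ≤ s * p k x + t * p k y := by
    intro k s t x y hs ht
    refine (map_add_le_add _ _ _).trans (le_of_eq ?_)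
    rw [← algebraMap_smul 𝕜 s x, ← algebraMap_smul 𝕜 t y, map_smul_eq_mul, map_smul_eq_mul,
      norm_algebraMap', norm_algebraMap', Real.norm_of_nonneg hs, Real.norm_of_nonneg ht]
  rintro x ⟨b, hb, hb'⟩ y ⟨c, hc, hc'⟩ s t hs ht hst
  refine ⟨s • b + t • c, ?_, fun k => ?_⟩
  · have : s • x + t • y - (s • b + t • c) = s • (x - b) + t • (y - c) := by
      rw [smul_sub, smul_sub]; abel
    rw [this]
    refine (hle n _ _ hs ht).trans ?_
    calc s * p n (x - b) + t * p n (y - c) ≤ s * ρ + t * ρ := by gcongr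
      _ = ρ := by rw [← add_mul, hst, one_mul]
  · refine (hle k _ _ hs ht).trans ?_
    calc s * p k b + t * p k c ≤ s * C k + t * C k := by
          gcongr
          · exact hb' k
          · exact hc' k
      _ = C k := by rw [← add_mul, hst, one_mul]

theorem mem_ballAddBox_of_le {n : ℕ} {ρ : ℝ} {C : ℕ → ℝ} (hC : ∀ k, 0 ≤ C k) {x : F}
    (hx : p n x ≤ ρ) : x ∈ ballAddBox p n ρ C :=
  ⟨0, by rwa [sub_zero], fun k => by rw [map_zero]; exact hC k⟩

theorem absorbent_ballAddBox [Module ℝ F] [IsScalarTower ℝ 𝕜 F] {n : ℕ} {ρ : ℝ} (hρ : 0 < ρ)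
    {C : ℕ → ℝ} (hC : ∀ k, 0 ≤ C k) : Absorbent ℝ (ballAddBox p n ρ C) := by
  have := ((p n).restrictScalars ℝ).absorbent_ball_zero hρ
  refine this.mono fun x hx => mem_ballAddBox_of_le hC ?_
  rw [Seminorm.mem_ball_zero] at hx
  exact hx.le

end BallAddBox

/-! ### The strong dual is barrelled -/

section StrongDual

variable {𝕜 F : Type*} [RCLike 𝕜] [AddCommGroup F] [Module 𝕜 F]

/-- The space `F` with the topology of a single seminorm. -/
def Seminorm.Space (_ : Seminorm 𝕜 F) : Type _ := F

noncomputable instance (P : Seminorm 𝕜 F) : SeminormedAddCommGroup P.Space :=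
  AddGroupSeminorm.toSeminormedAddCommGroup (E := F) P.toAddGroupSeminorm

instance (P : Seminorm 𝕜 F) : Module 𝕜 P.Space := inferInstanceAs (Module 𝕜 F)

noncomputable instance (P : Seminorm 𝕜 F) : NormedSpace 𝕜 P.Space where
  norm_smul_le c x := (map_smul_eq_mul P c (x : F)).le

/-- The identity map from `F` to the space `F` with a coarser seminorm topology. -/
def Seminorm.toSpace (P : Seminorm 𝕜 F) : F →ₗ[𝕜] P.Space := LinearMap.id

theorem Seminorm.norm_toSpace (P : Seminorm 𝕜 F) (x : F) : ‖P.toSpace x‖ = P x := rfl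

variable [TopologicalSpace F] [IsTopologicalAddGroup F]

/-- A lower semicontinuous seminorm on the strong dual is bounded on polars of neighbourhoods. -/
theorem LowerSemicontinuous.exists_le_of_le_seminorm {q : Seminorm 𝕜 (F →L[𝕜] 𝕜)}
    (hq : LowerSemicontinuous q) (P : Seminorm 𝕜 F) (hP : Continuous P) :
    ∃ c > (0 : ℝ), ∀ a ≥ (0 : ℝ), ∀ f : F →L[𝕜] 𝕜, (∀ x, ‖f x‖ ≤ a * P x) → q f ≤ c * a := by
  have hcont : Continuous P.toSpace := by
    refine continuous_of_continuousAt_zero P.toSpace ?_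
    rw [ContinuousAt, map_zero, tendsto_zero_iff_norm_tendsto_zero]
    simpa [Seminorm.norm_toSpace] using hP.tendsto 0
  let j : F →L[𝕜] P.Space := ⟨P.toSpace, hcont⟩
  let J : (P.Space →L[𝕜] 𝕜) →L[𝕜] (F →L[𝕜] 𝕜) := ContinuousLinearMap.precomp 𝕜 j
  -- The dual of a seminormed space is a Banach space, hence barrelled, so the pullback of `q` to it
  -- is continuous.
  have hlsc : LowerSemicontinuous (q.comp J.toLinearMap) := hq.comp J.continuous
  obtain ⟨c, hc, h⟩ := Seminorm.bound_of_continuous_normedSpace _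
    (Seminorm.continuous_of_lowerSemicontinuous _ hlsc)
  refine ⟨c, hc, fun a ha f hf => ?_⟩
  let g : P.Space →L[𝕜] 𝕜 :=
    LinearMap.mkContinuous (E := P.Space) (f.toLinearMap : F →ₗ[𝕜] 𝕜) a hf
  have hg : ‖g‖ ≤ a := LinearMap.mkContinuous_norm_le _ ha _
  have hfg : J g = f := rfl
  calc q f = q.comp J.toLinearMap g := by rw [← hfg]; rfl
    _ ≤ c * ‖g‖ := h g
    _ ≤ c * a := by gcongr

variable {p : SeminormFamily 𝕜 F ℕ}

/-- Bounded sets that control a lower semicontinuous seminorm on the polars of a basis of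
neighbourhoods. -/
theorem exists_boxes_of_bounded_approx (hp : WithSeminorms p)
    (Q : ∀ n, ∀ ε > (0 : ℝ), ∃ C : ℕ → ℝ, ∀ x, p (n + 1) x ≤ 1 →
      ∃ b, p n (x - b) ≤ ε ∧ ∀ k, p k b ≤ C k)
    {q : Seminorm 𝕜 (F →L[𝕜] 𝕜)} (hq : LowerSemicontinuous q) :
    ∃ C : ℕ → ℕ → ℝ, Monotone C ∧ (∀ n k, 0 ≤ C n k) ∧ ∀ n, ∀ g : F →L[𝕜] 𝕜,
      (∀ x, p n x ≤ (1 / 2) ^ n → ‖g x‖ ≤ 2) → (∀ b, (∀ k, p k b ≤ C n k) → ‖g b‖ ≤ 2) →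
      q g ≤ (1 / 2) ^ (n + 1) := by
  have key : ∀ n, ∃ C : ℕ → ℝ, ∀ g : F →L[𝕜] 𝕜,
      (∀ x, p n x ≤ (1 / 2) ^ n → ‖g x‖ ≤ 2) → (∀ b, (∀ k, p k b ≤ C k) → ‖g b‖ ≤ 2) →
      q g ≤ (1 / 2) ^ (n + 1) := by
    intro n
    obtain ⟨c, hc, hqc⟩ := hq.exists_le_of_le_seminorm (p (n + 1)) (hp.continuous_seminorm _)
    obtain ⟨η, hη, hηc⟩ : ∃ η > (0 : ℝ), c * η = (1 / 2) ^ (n + 1) :=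
      ⟨(1 / 2) ^ (n + 1) / c, by positivity, mul_div_cancel₀ _ hc.ne'⟩
    -- After scaling by `4 / η`, the ball of `p (n + 1)` of radius `4 / η` lies in the `2^{-n}`-ball
    -- of `p n` plus the scaled box. Bounds of `2` on both then give `‖g‖ ≤ η` on the unit ball of
    -- `p (n + 1)`.
    obtain ⟨C, hC⟩ := Q n (η / 4 * (1 / 2) ^ n) (by positivity)
    refine ⟨fun k => 4 / η * C k, fun g hg hg' => ?_⟩
    rw [← hηc]
    refine hqc η hη.le g fun x => ?_
    have hscale : ∀ (t : ℝ), 0 < t → ∀ z : F, ‖g (((t : ℝ) : 𝕜) • z)‖ = t * ‖g z‖ := by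
      intro t ht z
      rw [map_smul, norm_smul, RCLike.norm_ofReal, abs_of_pos ht]
    have hpscale : ∀ (t : ℝ), 0 < t → ∀ (k : ℕ) (z : F),
        p k (((t : ℝ) : 𝕜) • z) = t * p k z := by
      intro t ht k z
      rw [map_smul_eq_mul, RCLike.norm_ofReal, abs_of_pos ht]
    have hunit : ∀ z, p (n + 1) z ≤ 1 → ‖g z‖ ≤ η := by
      intro z hz
      obtain ⟨b, hb, hb'⟩ := hC z hz
      have h1 : ‖g (z - b)‖ ≤ η / 2 := by
        have := hg (((4 / η : ℝ) : 𝕜) • (z - b)) (by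
          rw [hpscale _ (by positivity)]
          calc 4 / η * p n (z - b) ≤ 4 / η * (η / 4 * (1 / 2) ^ n) := by gcongr
            _ = (1 / 2) ^ n := by field_simp)
        rw [hscale _ (by positivity), div_mul_eq_mul_div, div_le_iff₀ hη] at this
        linarith
      have h2 : ‖g b‖ ≤ η / 2 := by
        have := hg' (((4 / η : ℝ) : 𝕜) • b) (fun k => by
          rw [hpscale _ (by positivity)]
          exact mul_le_mul_of_nonneg_left (hb' k) (by positivity))
        rw [hscale _ (by positivity), div_mul_eq_mul_div, div_le_iff₀ hη] at this
        linarith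
      calc ‖g z‖ = ‖g (z - b) + g b‖ := by rw [← map_add, sub_add_cancel]
        _ ≤ ‖g (z - b)‖ + ‖g b‖ := norm_add_le _ _
        _ ≤ η := by linarith
    -- `p (n + 1) x` may vanish, so normalization uses a slightly larger number.
    refine le_of_forall_pos_lt_add fun δ hδ => ?_
    have ht : 0 < p (n + 1) x + δ / (2 * η) :=
      add_pos_of_nonneg_of_pos (apply_nonneg _ _) (by positivity)
    have := hunit ((((p (n + 1) x + δ / (2 * η))⁻¹ : ℝ) : 𝕜) • x) (by
      rw [hpscale _ (inv_pos.2 ht), inv_mul_le_iff₀ ht, mul_one]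
      exact le_add_of_nonneg_right (by positivity))
    rw [hscale _ (inv_pos.2 ht), inv_mul_le_iff₀ ht] at this
    calc ‖g x‖ ≤ (p (n + 1) x + δ / (2 * η)) * η := this
      _ = η * p (n + 1) x + δ / 2 := by field_simp
      _ < _ := by linarith
  choose C hC using key
  -- Partial sums make the boxes increase with `n`; enlarging a box only strengthens the hypothesis
  -- on `g`.
  refine ⟨fun n k => ∑ j ∈ Finset.range (n + 1), |C j k|, ?_, ?_, fun n g hg hg' => ?_⟩
  · intro m n hmn k
    exact Finset.sum_le_sum_of_subset_of_nonneg (Finset.range_mono (by omega))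
      fun _ _ _ => abs_nonneg _
  · exact fun n k => Finset.sum_nonneg fun _ _ => abs_nonneg _
  · refine hC n g hg fun b hb => hg' b fun k => (hb k).trans ((le_abs_self _).trans ?_)
    exact Finset.single_le_sum (f := fun j => |C j k|) (fun _ _ => abs_nonneg _)
      (Finset.self_mem_range_succ n)

theorem isDistinguished_of_bounded_approx [ContinuousSMul 𝕜 F] (hp : WithSeminorms p) (hmono : Monotone p)
    (Q : ∀ n, ∀ ε > (0 : ℝ), ∃ C : ℕ → ℝ, ∀ x, p (n + 1) x ≤ 1 →
      ∃ b, p n (x - b) ≤ ε ∧ ∀ k, p k b ≤ C k) :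
    IsDistinguished 𝕜 F := by
  let _ : Module ℝ F := .restrictScalars ℝ 𝕜 F
  have : IsScalarTower ℝ 𝕜 F := .restrictScalars _ _ _
  refine ⟨fun q hq => ?_⟩
  obtain ⟨C, hCmono, hC0, hCq⟩ := exists_boxes_of_bounded_approx hp Q hq
  have hpos : ∀ n : ℕ, (0 : ℝ) < (1 / 2) ^ n := fun n => by positivity
  let r : ℕ → Seminorm 𝕜 F := fun n =>
    gaugeSeminorm (balanced_ballAddBox (p := p) n ((1 / 2) ^ n) (C n))
      (convex_ballAddBox n _ _) (absorbent_ballAddBox (hpos n) (hC0 n))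
  have hr_lt : ∀ n x, r n x < 1 → x ∈ ballAddBox p n ((1 / 2) ^ n) (C n) := fun n x hx =>
    setOfPred_gauge_lt_one_subset_self (convex_ballAddBox n _ _)
      (mem_ballAddBox_of_le (hC0 n) (by rw [map_zero]; exact (hpos n).le))
      (absorbent_ballAddBox (hpos n) (hC0 n)) hx
  have hr_le : ∀ n x, x ∈ ballAddBox p n ((1 / 2) ^ n) (C n) → r n x ≤ 1 := fun n x hx =>
    gauge_le_one_of_mem hx
  -- The doubled radius leaves room for replacing `x` by its box component `b` below.
  let B : Set F := {x | ∀ n, x ∈ ballAddBox p n (2 * (1 / 2) ^ n) (C n)}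
  have hB : Bornology.IsVonNBounded 𝕜 B :=
    hp.isVonNBounded_of_forall_le (fun k => 2 * (1 / 2) ^ k + C k k) fun x hx k => by
      obtain ⟨b, hb, hb'⟩ := hx k
      rw [← sub_add_cancel x b]
      exact (map_add_le_add _ _ _).trans (add_le_add hb (hb' k))
  refine Seminorm.continuous' (r := 1) ?_
  filter_upwards [ContinuousLinearMap.eventually_nhds_zero_mapsTo (σ := RingHom.id 𝕜) hB
    (Metric.closedBall_mem_nhds (0 : 𝕜) one_pos)] with f hf
  have hfB : ∀ x ∈ B, ‖f x‖ ≤ 1 := fun x hx => by simpa using hf hx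
  rw [Seminorm.mem_closedBall_zero]
  obtain ⟨n, hn⟩ : ∃ n, ∀ x, p n x ≤ (1 / 2) ^ n → ‖f x‖ ≤ 1 := by
    have hnhds : f ⁻¹' Metric.ball 0 1 ∈ 𝓝 (0 : F) :=
      f.continuous.continuousAt.preimage_mem_nhds (by
        rw [map_zero]; exact Metric.ball_mem_nhds _ one_pos)
    obtain ⟨m, ρ, hρ, hm⟩ := hp.exists_ball_subset_of_monotone hmono hnhds
    obtain ⟨j, hj⟩ := exists_pow_lt_of_lt_one hρ (by norm_num : (1 / 2 : ℝ) < 1)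
    refine ⟨m + j, fun x hx => ?_⟩
    have : x ∈ (p m).ball 0 ρ := by
      rw [Seminorm.mem_ball_zero]
      calc p m x ≤ p (m + j) x := hmono (Nat.le_add_right m j) x
        _ ≤ (1 / 2) ^ (m + j) := hx
        _ ≤ (1 / 2) ^ j := pow_le_pow_of_le_one (by norm_num) (by norm_num) (by omega)
        _ < ρ := hj
    have := hm this
    simp only [Set.mem_preimage, mem_ball_zero_iff] at this
    exact this.le
  -- The box component `b` of `x` at level `n` lies in `B`: for `k ≥ n` because the boxes increase,
  -- for `k ≤ n` because `x` and `b` differ by at most `2^{-n} ≤ 2^{-k}` in `p k`. Only finitely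
  -- many of the conditions defining `B` are thus imposed on `x`.
  have hfA : ∀ x, (∀ k ≤ n, x ∈ ballAddBox p k ((1 / 2) ^ k) (C k)) → ‖f x‖ ≤ 2 := by
    intro x hx
    obtain ⟨b, hb, hb'⟩ := hx n le_rfl
    have hbB : b ∈ B := by
      intro k
      rcases le_total n k with hk | hk
      · exact ⟨b, by rw [sub_self, map_zero]; positivity, fun i => (hb' i).trans (hCmono hk i)⟩
      · obtain ⟨c, hc, hc'⟩ := hx k hk
        refine ⟨c, ?_, hc'⟩
        have h1 : b - c = (x - c) - (x - b) := by abel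
        rw [h1]
        calc p k ((x - c) - (x - b)) ≤ p k (x - c) + p k (x - b) := map_sub_le_add _ _ _
          _ ≤ (1 / 2) ^ k + (1 / 2) ^ n := add_le_add hc ((hmono hk _).trans hb)
          _ ≤ (1 / 2) ^ k + (1 / 2) ^ k := by
              gcongr 1
              exact pow_le_pow_of_le_one (by norm_num) (by norm_num) hk
          _ = 2 * (1 / 2) ^ k := by ring
    calc ‖f x‖ = ‖f (x - b) + f b‖ := by rw [← map_add, sub_add_cancel]
      _ ≤ ‖f (x - b)‖ + ‖f b‖ := norm_add_le _ _
      _ ≤ 1 + 1 := add_le_add (hn _ hb) (hfB b hbB)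
      _ = 2 := by norm_num
  have hfr : ∀ x, ‖f x‖ ≤ ∑ k ∈ Finset.range (n + 1), ((2 : NNReal) • r k) x := by
    intro x
    have h2 : ∑ k ∈ Finset.range (n + 1), ((2 : NNReal) • r k) x
        = 2 * ∑ k ∈ Finset.range (n + 1), r k x := by
      rw [Finset.mul_sum]; rfl
    rw [h2]
    have hS0 : 0 ≤ ∑ k ∈ Finset.range (n + 1), r k x :=
      Finset.sum_nonneg fun _ _ => apply_nonneg _ _
    refine le_of_forall_pos_lt_add fun δ hδ => ?_
    set t : ℝ := ∑ k ∈ Finset.range (n + 1), r k x + δ / 4 with ht_def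
    have ht : 0 < t := by positivity
    have hnorm : ‖((t⁻¹ : ℝ) : 𝕜)‖ = t⁻¹ := by
      rw [RCLike.norm_ofReal, abs_of_pos (inv_pos.2 ht)]
    have := hfA (((t⁻¹ : ℝ) : 𝕜) • x) fun k hk => hr_lt k _ (by
      rw [map_smul_eq_mul, hnorm, inv_mul_lt_iff₀ ht, mul_one]
      have : r k x ≤ ∑ k ∈ Finset.range (n + 1), r k x :=
        Finset.single_le_sum (f := fun k => r k x) (fun _ _ => apply_nonneg _ _)
          (Finset.mem_range_succ_iff.2 hk)
      linarith)
    rw [map_smul, norm_smul, hnorm, inv_mul_le_iff₀ ht] at this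
    linarith
  obtain ⟨g, hfg, hg⟩ := Module.Dual.exists_sum_of_le_seminorm_sum _ _ f.toLinearMap hfr
  have hgr : ∀ k ∈ Finset.range (n + 1), ∀ x, ‖g k x‖ ≤ 2 * r k x := hg
  -- The gauge `r k` is dominated by a multiple of `p k`, since its set contains a ball of `p k`.
  have hgcont : ∀ k ∈ Finset.range (n + 1), Continuous (g k) := by
    intro k hk
    refine continuous_of_continuousAt_zero (g k) ?_
    rw [ContinuousAt, map_zero, Metric.tendsto_nhds]
    intro δ hδ
    filter_upwards [hp.ball_zero_mem_nhds k (r := δ / 4 * (1 / 2) ^ k) (by positivity)] with x hx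
    rw [Seminorm.mem_ball_zero] at hx
    have hnorm : ‖((4 / δ : ℝ) : 𝕜)‖ = 4 / δ := by
      rw [RCLike.norm_ofReal, abs_of_pos (by positivity)]
    have h3 : r k (((4 / δ : ℝ) : 𝕜) • x) ≤ 1 := hr_le k _ (mem_ballAddBox_of_le (hC0 k) (by
      rw [map_smul_eq_mul, hnorm]
      calc 4 / δ * p k x ≤ 4 / δ * (δ / 4 * (1 / 2) ^ k) := by gcongr
        _ = (1 / 2) ^ k := by field_simp))
    rw [map_smul_eq_mul, hnorm, div_mul_eq_mul_div, div_le_iff₀ hδ] at h3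
    rw [dist_zero_right]
    linarith [hgr k hk x]
  classical
  let G : ℕ → (F →L[𝕜] 𝕜) := fun k =>
    if hk : k ∈ Finset.range (n + 1) then ⟨g k, hgcont k hk⟩ else 0
  have hG : ∀ k ∈ Finset.range (n + 1), ∀ x, G k x = g k x := fun k hk x => by
    simp only [G, dif_pos hk]; rfl
  have hfG : f = ∑ k ∈ Finset.range (n + 1), G k := by
    ext x
    have h4 : f x = (∑ k ∈ Finset.range (n + 1), g k) x := by rw [← hfg]; rfl
    rw [h4, LinearMap.sum_apply, sum_apply]
    exact Finset.sum_congr rfl fun k hk => (hG k hk x).symm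
  have hqG : ∀ k ∈ Finset.range (n + 1), q (G k) ≤ (1 / 2) ^ (k + 1) := by
    intro k hk
    have h5 : ∀ x ∈ ballAddBox p k ((1 / 2) ^ k) (C k), ‖G k x‖ ≤ 2 := fun x hx => by
      rw [hG k hk]
      linarith [hgr k hk x, hr_le k x hx]
    refine hCq k (G k) (fun x hx => h5 x (mem_ballAddBox_of_le (hC0 k) hx)) fun b hb => h5 b ?_
    exact ⟨b, by rw [sub_self, map_zero]; exact (hpos k).le, hb⟩
  have hgeom : ∀ m : ℕ, ∑ k ∈ Finset.range m, (1 / 2 : ℝ) ^ (k + 1) = 1 - (1 / 2) ^ m := by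
    intro m
    induction m with
    | zero => simp
    | succ m ih => rw [Finset.sum_range_succ, ih]; ring
  calc q f = q (∑ k ∈ Finset.range (n + 1), G k) := by rw [← hfG]
    _ ≤ ∑ k ∈ Finset.range (n + 1), q (G k) := Finset.le_sum_of_subadditive q (map_zero q).le (map_add_le_add q) _ _
    _ ≤ ∑ k ∈ Finset.range (n + 1), (1 / 2) ^ (k + 1) := Finset.sum_le_sum hqG
    _ = 1 - (1 / 2) ^ (n + 1) := hgeom _
    _ ≤ 1 := sub_le_self _ (hpos _).le

end StrongDual

/-! ### Uniform Lipschitz and Taylor estimates for translates -/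

section TranslationEstimates

open scoped ContDiff

variable {d : ℕ}

/-- The function and its derivatives are Lipschitz. Induction replaces `φ` by `fderiv ℝ φ`, whence
the general target `G`. -/
theorem exists_norm_iteratedFDeriv_translate_sub_le {G : Type*}
    [NormedAddCommGroup G] [NormedSpace ℝ G] (i : ℕ) {φ : EuclideanSpace ℝ (Fin d) → G}
    (hφ : ContDiff ℝ ∞ φ) (hc : HasCompactSupport φ) :
    ∃ C : ℝ, ∀ x y, ‖iteratedFDeriv ℝ i (fun z => φ (z - x) - φ z) y‖ ≤ C * ‖x‖ := by
  induction i generalizing G with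
  | zero =>
    obtain ⟨C, hC⟩ := ContDiff.lipschitzWith_of_hasCompactSupport hc hφ (by simp)
    refine ⟨C, fun x y => ?_⟩
    rw [norm_iteratedFDeriv_zero]
    simpa using hC.norm_sub_le (y - x) y
  | succ i ih =>
    obtain ⟨C, hC⟩ := ih (hφ.fderiv_right (m := ∞) (by simp)) (hc.fderiv ℝ)
    refine ⟨C, fun x y => ?_⟩
    rw [← norm_iteratedFDeriv_fderiv]
    have hd : Differentiable ℝ φ := hφ.differentiable (by simp)
    have : fderiv ℝ (fun z => φ (z - x) - φ z) = fun z => fderiv ℝ φ (z - x) - fderiv ℝ φ z := by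
      ext1 z
      have h1 : DifferentiableAt ℝ (fun z => φ (z - x)) z :=
        hd.comp (differentiable_id.sub_const _) z
      rw [fderiv_fun_sub h1 (hd z), fderiv_comp_sub]
    rw [this]
    exact hC x y

theorem exists_norm_iteratedFDeriv_taylor_le {G : Type*}
    [NormedAddCommGroup G] [NormedSpace ℝ G] (i : ℕ) {φ : EuclideanSpace ℝ (Fin d) → G}
    (hφ : ContDiff ℝ ∞ φ) (hc : HasCompactSupport φ) (v : EuclideanSpace ℝ (Fin d)) :
    ∃ C : ℝ, ∀ (h : ℝ) (y : EuclideanSpace ℝ (Fin d)),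
      ‖iteratedFDeriv ℝ i (fun z => φ (z - h • v) - φ z + h • fderiv ℝ φ z v) y‖ ≤ C * h ^ 2 := by
  induction i generalizing G with
  | zero =>
    have hd : Differentiable ℝ φ := hφ.differentiable (by simp)
    obtain ⟨L, hL⟩ := ContDiff.lipschitzWith_of_hasCompactSupport (hc.fderiv ℝ)
      (hφ.fderiv_right (m := ∞) (by simp)) (by simp)
    refine ⟨L * ‖v‖ * ‖v‖, fun h y => ?_⟩
    rw [norm_iteratedFDeriv_zero]
    let g : ℝ → G := fun t => φ (y - t • v) + t • fderiv ℝ φ y v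
    have hg : ∀ t, HasDerivAt g (-(fderiv ℝ φ (y - t • v) v) + fderiv ℝ φ y v) t := by
      intro t
      have h1 : HasDerivAt (fun t : ℝ => y - t • v) (-v) t := by
        simpa using ((hasDerivAt_id t).smul_const v).const_sub y
      have h2 := (hd (y - t • v)).hasFDerivAt.comp_hasDerivAt t h1
      have h3 : HasDerivAt (fun t : ℝ => t • fderiv ℝ φ y v) (fderiv ℝ φ y v) t := by
        simpa using (hasDerivAt_id t).smul_const (fderiv ℝ φ y v)
      rw [map_neg] at h2
      exact h2.add h3
    have hbound : ∀ t ∈ Set.uIcc 0 h,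
        ‖-(fderiv ℝ φ (y - t • v) v) + fderiv ℝ φ y v‖ ≤ L * ‖v‖ * ‖v‖ * |h| := by
      intro t ht
      have ht' : |t| ≤ |h| := by simpa using Set.abs_sub_left_of_mem_uIcc ht
      rw [neg_add_eq_sub, ← sub_apply]
      refine (ContinuousLinearMap.le_opNorm _ _).trans ?_
      have := hL.norm_sub_le y (y - t • v)
      rw [sub_sub_cancel, norm_smul, Real.norm_eq_abs] at this
      calc ‖fderiv ℝ φ y - fderiv ℝ φ (y - t • v)‖ * ‖v‖ ≤ (L * (|t| * ‖v‖)) * ‖v‖ := by gcongr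
        _ ≤ (L * (|h| * ‖v‖)) * ‖v‖ := by gcongr
        _ = _ := by ring
    have := (convex_uIcc 0 h).norm_image_sub_le_of_norm_hasDerivWithin_le
      (fun t _ => (hg t).hasDerivWithinAt) hbound Set.left_mem_uIcc Set.right_mem_uIcc
    have hgh : g h - g 0 = φ (y - h • v) - φ y + h • fderiv ℝ φ y v := by
      simp only [g, zero_smul, sub_zero, add_zero]; abel
    rw [hgh, sub_zero, Real.norm_eq_abs, mul_assoc, ← sq, sq_abs] at this
    exact this
  | succ i ih =>
    obtain ⟨C, hC⟩ := ih (hφ.fderiv_right (m := ∞) (by simp)) (hc.fderiv ℝ)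
    refine ⟨C, fun h y => ?_⟩
    rw [← norm_iteratedFDeriv_fderiv]
    have hd : Differentiable ℝ φ := hφ.differentiable (by simp)
    have hd2 : Differentiable ℝ (fderiv ℝ φ) :=
      (hφ.fderiv_right (m := ∞) (by simp)).differentiable (by simp)
    have : fderiv ℝ (fun z => φ (z - h • v) - φ z + h • fderiv ℝ φ z v) =
        fun z => fderiv ℝ φ (z - h • v) - fderiv ℝ φ z + h • fderiv ℝ (fderiv ℝ φ) z v := by
      ext z w
      have h1 : DifferentiableAt ℝ (fun z => φ (z - h • v)) z :=
        hd.comp (differentiable_id.sub_const _) z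
      have h2 : DifferentiableAt ℝ (fun z => fderiv ℝ φ z v) z :=
        (hd2 z).clm_apply (differentiableAt_const v)
      rw [fderiv_fun_add (h1.fun_sub (hd z)) (h2.fun_const_smul h), fderiv_fun_sub h1 (hd z),
        fderiv_comp_sub, fderiv_fun_const_smul h2, fderiv_clm_apply (hd2 z)
        (differentiableAt_const v)]
      -- Differentiating the linear term in direction `w` gives `D²φ(w, v)`, while the induction
      -- hypothesis for `fderiv ℝ φ` involves `D²φ(v, w)`.
      have hsymm : IsSymmSndFDerivAt ℝ φ z :=
        (contDiff_infty.1 hφ 2).contDiffAt.isSymmSndFDerivAt (by simp)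
      simp [hsymm.eq v w]
    rw [this]
    exact hC h y

end TranslationEstimates

/-! ### Continuity and differentiability of translation on test functions -/

namespace TestFn

open scoped ContDiff

variable {d : ℕ} {𝕜 : Type*} [RCLike 𝕜]

/-- The `𝕜`-valued test function `y ↦ φ (y - x)`. -/
noncomputable def shiftBy (x : EuclideanSpace ℝ (Fin d)) (φ : TestFn d 𝕜) : TestFn d 𝕜 where
  toFun y := φ (y - x)
  contDiff' := φ.contDiff.comp (contDiff_id.sub contDiff_const)
  hasCompactSupport' := φ.hasCompactSupport.comp_homeomorph (Homeomorph.subRight x)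
  tsupport_subset' := fun _ _ => trivial

theorem shiftBy_apply (x y : EuclideanSpace ℝ (Fin d)) (φ : TestFn d 𝕜) :
    shiftBy x φ y = φ (y - x) := rfl

theorem shiftBy_zero (φ : TestFn d 𝕜) : shiftBy 0 φ = φ := by
  ext y; rw [shiftBy_apply, sub_zero]

theorem shiftBy_add (x y : EuclideanSpace ℝ (Fin d)) (φ : TestFn d 𝕜) :
    shiftBy (x + y) φ = shiftBy x (shiftBy y φ) := by
  ext z; rw [shiftBy_apply, shiftBy_apply, shiftBy_apply, sub_sub]

/-- Test functions with supports in a fixed compact set converge to zero if all their derivatives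
do so uniformly. -/
theorem tendsto_zero_of_norm_iteratedFDeriv_le {ι : Type*} {l : Filter ι} {u : ι → TestFn d 𝕜}
    {K : Set (EuclideanSpace ℝ (Fin d))} (hK : IsCompact K)
    (hsupp : ∀ᶠ j in l, ∀ y ∉ K, u j y = 0)
    (hu : ∀ i, ∃ b : ι → ℝ, Tendsto b l (𝓝 0) ∧ ∀ᶠ j in l, ∀ y,
      ‖iteratedFDeriv ℝ i (u j) y‖ ≤ b j) :
    Tendsto u l (𝓝 0) := by
  classical
  let K' : Compacts (EuclideanSpace ℝ (Fin d)) := ⟨K, hK⟩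
  let w : ι → 𝓓_{K'}(EuclideanSpace ℝ (Fin d), 𝕜) := fun j =>
    if h : ∀ y ∉ K, u j y = 0 then ⟨u j, (u j).contDiff, fun y hy => h y hy⟩ else 0
  have hw : ∀ᶠ j in l, TestFunction.ofSupportedInCLM ℝ (Ω := ⊤) (K := K') (fun _ _ => trivial)
      (w j) = u j := by
    filter_upwards [hsupp] with j hj
    ext y
    simp only [w, dif_pos hj]
    rfl
  have hw0 : Tendsto w l (𝓝 0) := by
    rw [(ContDiffMapSupportedIn.withSeminorms ℝ _ _ _ _).tendsto_nhds]
    intro i ε hε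
    obtain ⟨b, hb, hub⟩ := hu i
    filter_upwards [hsupp, hub, hb.eventually_lt_const (half_pos hε)] with j hj hj' hbj
    rw [sub_zero]
    refine lt_of_le_of_lt ?_ (half_lt_self hε)
    rw [ContDiffMapSupportedIn.seminorm_le_iff ℝ (half_pos hε).le]
    intro _ y _
    simp only [w, dif_pos hj]
    exact (hj' y).trans hbj.le
  have := ((TestFunction.ofSupportedInCLM ℝ (Ω := ⊤) (F := 𝕜) (n := ⊤) (K := K')
    (fun _ _ => trivial)).continuous.tendsto 0).comp hw0
  rw [map_zero] at this
  exact this.congr' hw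

theorem isCompact_tsupport_add_closedBall (φ : TestFn d 𝕜) (R : ℝ) :
    IsCompact (tsupport φ + Metric.closedBall (0 : EuclideanSpace ℝ (Fin d)) R) :=
  IsCompact.add φ.hasCompactSupport (isCompact_closedBall 0 R)

theorem apply_sub_eq_zero_of_notMem (φ : TestFn d 𝕜) {R : ℝ} {x y : EuclideanSpace ℝ (Fin d)}
    (hx : ‖x‖ ≤ R) (hy : y ∉ tsupport φ + Metric.closedBall (0 : EuclideanSpace ℝ (Fin d)) R) :
    φ (y - x) = 0 := by
  by_contra h
  exact hy (Set.mem_add.2 ⟨y - x, subset_tsupport _ h, x, by simpa using hx, sub_add_cancel _ _⟩)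

theorem continuous_shiftBy (φ : TestFn d 𝕜) :
    Continuous fun x : EuclideanSpace ℝ (Fin d) => shiftBy x φ := by
  have h0 : ∀ ψ : TestFn d 𝕜, Tendsto (fun x => shiftBy x ψ - ψ) (𝓝 0) (𝓝 0) := by
    intro ψ
    refine tendsto_zero_of_norm_iteratedFDeriv_le (isCompact_tsupport_add_closedBall ψ 1) ?_ ?_
    · filter_upwards [Metric.closedBall_mem_nhds (0 : EuclideanSpace ℝ (Fin d)) one_pos]
        with x hx y hy
      have h1 := apply_sub_eq_zero_of_notMem ψ (by simpa using hx) hy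
      have h2 := apply_sub_eq_zero_of_notMem ψ (x := 0) (by simp) hy
      rw [sub_zero] at h2
      change ψ (y - x) - ψ y = 0
      rw [h1, h2, sub_zero]
    · intro i
      obtain ⟨C, hC⟩ := exists_norm_iteratedFDeriv_translate_sub_le i
        ψ.contDiff ψ.hasCompactSupport
      refine ⟨fun x => C * ‖x‖, ?_, Eventually.of_forall fun x y => hC x y⟩
      have : Continuous fun x : EuclideanSpace ℝ (Fin d) => C * ‖x‖ := by fun_prop
      simpa using this.tendsto 0
  rw [continuous_iff_continuousAt]
  intro x₀
  have h1 : Tendsto (fun x => x - x₀) (𝓝 x₀) (𝓝 0) := by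
    have : Continuous fun x : EuclideanSpace ℝ (Fin d) => x - x₀ := by fun_prop
    simpa using this.tendsto x₀
  have h2 := ((h0 (shiftBy x₀ φ)).comp h1).add_const (shiftBy x₀ φ)
  rw [zero_add] at h2
  refine h2.congr fun x => ?_
  rw [Function.comp_apply, sub_add_cancel, ← shiftBy_add, sub_add_cancel]

theorem lineDerivCLM_apply_eq_fderiv (v y : EuclideanSpace ℝ (Fin d)) (φ : TestFn d ℝ) :
    (TestFunction.lineDerivCLM ℝ v φ : TestFn d ℝ) y = fderiv ℝ φ y v := by
  rw [TestFunction.lineDerivCLM_eq_fderivCLM, TestFunction.fderivCLM_apply_of_le φ (by simp)]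

/-- Every derivative of the Taylor remainder is `O(h²)`, hence `O(h)` after division by `h`, and for
`|h| ≤ 1` all supports stay within distance `‖v‖` of that of `φ`. -/
theorem tendsto_slope_shift (φ : TestFn d ℝ) (v : EuclideanSpace ℝ (Fin d)) :
    Tendsto (fun h : ℝ => h⁻¹ • (shift (h • v) φ - φ)) (𝓝[≠] 0)
      (𝓝 (-(TestFunction.lineDerivCLM ℝ v φ : TestFn d ℝ))) := by
  rw [← tendsto_sub_nhds_zero_iff]
  have hfun : ∀ h : ℝ, h ≠ 0 → ∀ y,
      (h⁻¹ • (shift (h • v) φ - φ) - -(TestFunction.lineDerivCLM ℝ v φ : TestFn d ℝ)) y =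
        h⁻¹ • (φ (y - h • v) - φ y + h • fderiv ℝ φ y v) := by
    intro h hh y
    have : (h⁻¹ • (shift (h • v) φ - φ) - -(TestFunction.lineDerivCLM ℝ v φ : TestFn d ℝ)) y =
        h⁻¹ • (φ (y - h • v) - φ y) - -(TestFunction.lineDerivCLM ℝ v φ : TestFn d ℝ) y := rfl
    rw [this, lineDerivCLM_apply_eq_fderiv, smul_add, inv_smul_smul₀ hh, sub_neg_eq_add]
  refine tendsto_zero_of_norm_iteratedFDeriv_le
    (isCompact_tsupport_add_closedBall φ ‖v‖) ?_ ?_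
  · filter_upwards [self_mem_nhdsWithin,
      nhdsWithin_le_nhds (Metric.closedBall_mem_nhds (0 : ℝ) one_pos)] with h hh hh1 y hy
    have hh2 : |h| ≤ 1 := by simpa using hh1
    have h1 := apply_sub_eq_zero_of_notMem φ (x := h • v) (by
      rw [norm_smul, Real.norm_eq_abs]
      exact mul_le_of_le_one_left (norm_nonneg v) hh2) hy
    have h2 := apply_sub_eq_zero_of_notMem φ (x := 0) (by simp) hy
    have h3 : fderiv ℝ φ y = 0 := by
      by_contra h3
      refine hy (Set.mem_add.2 ⟨y, ?_, 0, by simp, add_zero _⟩)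
      exact tsupport_fderiv_subset ℝ (subset_tsupport _ h3)
    rw [sub_zero] at h2
    rw [hfun h hh, h1, h2, h3]
    simp
  · intro i
    obtain ⟨C, hC⟩ := exists_norm_iteratedFDeriv_taylor_le i φ.contDiff φ.hasCompactSupport v
    refine ⟨fun h => C * |h|, ?_, ?_⟩
    · have : Continuous fun h : ℝ => C * |h| := by fun_prop
      have := this.tendsto 0
      rw [abs_zero, mul_zero] at this
      exact this.mono_left nhdsWithin_le_nhds
    · filter_upwards [self_mem_nhdsWithin] with h hh y
      have hh' : h ≠ 0 := hh
      have h1 : ((h⁻¹ • (shift (h • v) φ - φ) -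
          -(TestFunction.lineDerivCLM ℝ v φ : TestFn d ℝ) : TestFn d ℝ) :
          EuclideanSpace ℝ (Fin d) → ℝ) =
          h⁻¹ • fun y => φ (y - h • v) - φ y + h • fderiv ℝ φ y v := by
        ext y; exact hfun h hh y
      have hsm : ContDiff ℝ ∞ fun y => φ (y - h • v) - φ y + h • fderiv ℝ φ y v := by
        have h2 : ContDiff ℝ ∞ fun y => fderiv ℝ φ y v :=
          (φ.contDiff.fderiv_right (m := ∞) (by simp)).clm_apply contDiff_const
        exact ((φ.contDiff.comp (contDiff_id.sub contDiff_const)).sub φ.contDiff).add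
          (h2.const_smul h)
      rw [h1, iteratedFDeriv_const_smul_apply (hsm.of_le (by exact_mod_cast le_top)).contDiffAt,
        norm_smul, norm_inv, Real.norm_eq_abs, inv_mul_le_iff₀ (abs_pos.2 hh')]
      refine (hC h y).trans (le_of_eq ?_)
      rw [← sq_abs]; ring

/-- The derivative of a distribution along the translates of a test function. -/
theorem hasDerivAt_distr_shift (f : Distr d 𝕜) (φ : TestFn d ℝ) (v : EuclideanSpace ℝ (Fin d))
    (t : ℝ) :
    HasDerivAt (fun t : ℝ => f (shift (t • v) φ))
      (Distribution.lineDerivCLM v f (shift (t • v) φ)) t := by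
  rw [hasDerivAt_iff_tendsto_slope_zero]
  have h1 : Tendsto (fun h : ℝ => f (h⁻¹ • (shift (h • v) (shift (t • v) φ) - shift (t • v) φ)))
      (𝓝[≠] 0) (𝓝 (f (-(TestFunction.lineDerivCLM ℝ v (shift (t • v) φ) : TestFn d ℝ)))) :=
    (f.continuous.tendsto _).comp (tendsto_slope_shift (shift (t • v) φ) v)
  have hneg : f (-(TestFunction.lineDerivCLM ℝ v (shift (t • v) φ) : TestFn d ℝ)) =
      Distribution.lineDerivCLM v f (shift (t • v) φ) := map_neg f _
  rw [hneg] at h1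
  refine h1.congr fun h => ?_
  have h2 : shift ((t + h) • v) φ = shift (h • v) (shift (t • v) φ) := by
    rw [add_smul, add_comm]
    exact shiftBy_add (𝕜 := ℝ) (h • v) (t • v) φ
  rw [h2]
  exact (map_smul f _ _).trans (congrArg _ (map_sub f _ _))

end TestFn

/-! ### Derivatives as commuting, translation-invariant operators -/

section TranslationInvariantOperators

variable {d : ℕ} {𝕜 : Type*} [RCLike 𝕜]

theorem Distr.translate_smul (x : EuclideanSpace ℝ (Fin d)) (c : 𝕜) (f : Distr d 𝕜) :
    Distr.translate x (c • f) = c • Distr.translate x f := rfl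

/-- The operators on distributions that are transposes of operators on test functions commuting
with translations. -/
def Distr.translationInvariantOps (d : ℕ) (𝕜 : Type*) [RCLike 𝕜] :
    Submonoid (Distr d 𝕜 →L[ℝ] Distr d 𝕜) where
  carrier := {D | ∃ P : TestFn d ℝ → TestFn d ℝ, (∀ f φ, D f φ = f (P φ)) ∧
    ∀ x φ, P (TestFn.shift x φ) = TestFn.shift x (P φ)}
  one_mem' := ⟨id, fun _ _ => rfl, fun _ _ => rfl⟩
  mul_mem' := by
    rintro D₁ D₂ ⟨P₁, h₁, h₁'⟩ ⟨P₂, h₂, h₂'⟩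
    refine ⟨fun φ => P₂ (P₁ φ), fun f φ => ?_, fun x φ => ?_⟩
    · rw [mul_apply_eq_comp, h₁, h₂]
    · simp only [h₁', h₂']

theorem TestFn.lineDerivCLM_shift (v x : EuclideanSpace ℝ (Fin d)) (φ : TestFn d ℝ) :
    (TestFunction.lineDerivCLM ℝ v (TestFn.shift x φ) : TestFn d ℝ) =
      TestFn.shift x (TestFunction.lineDerivCLM ℝ v φ) := by
  ext y
  have h1 : TestFn.shift x (TestFunction.lineDerivCLM ℝ v φ) y =
    (TestFunction.lineDerivCLM ℝ v φ : TestFn d ℝ) (y - x) := rfl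
  rw [h1, TestFn.lineDerivCLM_apply_eq_fderiv, TestFn.lineDerivCLM_apply_eq_fderiv]
  have h2 : (TestFn.shift x φ : EuclideanSpace ℝ (Fin d) → ℝ) = fun z => φ (z - x) := rfl
  rw [h2, fderiv_comp_sub]

theorem TestFn.lineDerivCLM_comm (v w : EuclideanSpace ℝ (Fin d)) (φ : TestFn d ℝ) :
    (TestFunction.lineDerivCLM ℝ v (TestFunction.lineDerivCLM ℝ w φ : TestFn d ℝ) : TestFn d ℝ) =
      TestFunction.lineDerivCLM ℝ w (TestFunction.lineDerivCLM ℝ v φ : TestFn d ℝ) := by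
  have key : ∀ a b y : EuclideanSpace ℝ (Fin d), (TestFunction.lineDerivCLM ℝ a
      (TestFunction.lineDerivCLM ℝ b φ : TestFn d ℝ) : TestFn d ℝ) y =
      fderiv ℝ (fderiv ℝ φ) y a b := by
    intro a b y
    rw [TestFn.lineDerivCLM_apply_eq_fderiv]
    have h1 : ((TestFunction.lineDerivCLM ℝ b φ : TestFn d ℝ) : EuclideanSpace ℝ (Fin d) → ℝ) =
        fun z => fderiv ℝ φ z b := by
      ext z; exact TestFn.lineDerivCLM_apply_eq_fderiv b z φ
    have h2 : DifferentiableAt ℝ (fderiv ℝ φ) y :=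
      ((contDiff_infty.1 φ.contDiff 2).fderiv_right (m := 1) (by norm_num)).differentiable
        (by simp) y
    rw [h1, fderiv_clm_apply h2 (differentiableAt_const b)]
    simp
  ext y
  rw [key, key]
  exact ((contDiff_infty.1 φ.contDiff 2).contDiffAt.isSymmSndFDerivAt (by simp)).eq v w

theorem Distr.lineDerivCLM_mem_translationInvariantOps (v : EuclideanSpace ℝ (Fin d)) :
    (Distribution.lineDerivCLM v : Distr d 𝕜 →L[ℝ] Distr d 𝕜) ∈
      Distr.translationInvariantOps d 𝕜 :=
  ⟨fun φ => -TestFunction.lineDerivCLM ℝ v φ, fun f _ => (map_neg f _).symm, fun x φ => by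
    simp only [TestFn.lineDerivCLM_shift]; rfl⟩

theorem Distr.partialDeriv_mem_translationInvariantOps (α : Fin d → ℕ) :
    (Distr.partialDeriv α : Distr d 𝕜 →L[ℝ] Distr d 𝕜) ∈ Distr.translationInvariantOps d 𝕜 := by
  refine Submonoid.list_prod_mem _ fun D hD => ?_
  obtain ⟨i, -, rfl⟩ := List.mem_map.1 hD
  exact Submonoid.pow_mem _ (Distr.lineDerivCLM_mem_translationInvariantOps _) _

theorem Distr.commute_lineDerivCLM (v w : EuclideanSpace ℝ (Fin d)) :
    Commute (Distribution.lineDerivCLM v : Distr d 𝕜 →L[ℝ] Distr d 𝕜)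
      (Distribution.lineDerivCLM w) := by
  ext f φ
  change -(-f _) = -(-f _)
  exact congrArg (fun ψ => -(-f ψ)) (TestFn.lineDerivCLM_comm w v φ)

/-- Commutativity moves the extra factor `D j` to the front; without repetitions in `l` it occurs at
most once. -/
theorem List.prod_map_pow_add_single {ι R : Type*} [DecidableEq ι] [Monoid R] (D : ι → R)
    (hD : ∀ i j, Commute (D i) (D j)) (α : ι → ℕ) (j : ι) (l : List ι) (hl : l.Nodup) :
    (l.map fun i => D i ^ (α + Pi.single j 1 : ι → ℕ) i).prod =
      if j ∈ l then D j * (l.map fun i => D i ^ α i).prod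
      else (l.map fun i => D i ^ α i).prod := by
  induction l with
  | nil => simp
  | cons a l ih =>
    rw [List.nodup_cons] at hl
    simp only [List.map_cons, List.prod_cons, ih hl.2, List.mem_cons]
    by_cases haj : j = a
    · subst haj
      simp [hl.1, pow_succ', mul_assoc]
    · have h1 : (α + Pi.single j 1 : ι → ℕ) a = α a := by
        simp [Pi.single_eq_of_ne (Ne.symm haj)]
      rw [h1]
      by_cases hj : j ∈ l
      · simp only [hj, or_true, if_true]
        rw [← mul_assoc, ← mul_assoc, ((hD j a).pow_right (α a)).eq]
      · simp [hj, haj]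

theorem Distr.partialDeriv_add_single (α : Fin d → ℕ) (j : Fin d) (f : Distr d 𝕜) :
    Distr.partialDeriv (α + Pi.single j 1) f =
      Distribution.lineDerivCLM (EuclideanSpace.single j (1 : ℝ)) (Distr.partialDeriv α f) := by
  have := List.prod_map_pow_add_single (fun i : Fin d =>
    (Distribution.lineDerivCLM (EuclideanSpace.single i (1 : ℝ)) : Distr d 𝕜 →L[ℝ] Distr d 𝕜))
    (fun i j => Distr.commute_lineDerivCLM _ _) α j (List.finRange d) (List.nodup_finRange d)
  rw [if_pos (List.mem_finRange j)] at this
  exact congrArg (fun D : Distr d 𝕜 →L[ℝ] Distr d 𝕜 => D f) this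

theorem Distr.partialDeriv_zero (f : Distr d 𝕜) : Distr.partialDeriv 0 f = f := by
  have : (Distr.partialDeriv 0 : Distr d 𝕜 →L[ℝ] Distr d 𝕜) = 1 :=
    List.prod_eq_one fun D hD => by
      obtain ⟨i, -, rfl⟩ := List.mem_map.1 hD
      exact pow_zero _
  rw [this]; rfl

end TranslationInvariantOperators

/-! ### The translation group on `E` and its averages -/

namespace TIBD

variable {d : ℕ} {𝕜 : Type*} [RCLike 𝕜] {E : Type*} [NormedAddCommGroup E]
  [NormedSpace 𝕜 E] [CompleteSpace E] (h : TIBD d 𝕜 E)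

/-- Evaluation of the elements of `E` at a test function. -/
noncomputable def pairing (φ : TestFn d ℝ) : E →L[𝕜] 𝕜 where
  toFun e := h.toDistr e φ
  map_add' a b := by rw [map_add]; rfl
  map_smul' c a := by rw [map_smul]; rfl
  cont := (continuous_eval_const φ).comp h.toDistr.continuous

theorem pairing_apply (φ : TestFn d ℝ) (e : E) : h.pairing φ e = h.toDistr e φ := rfl

theorem eq_of_pairing_eq {a b : E} (hab : ∀ φ, h.pairing φ a = h.pairing φ b) : a = b :=
  h.injective_toDistr (DFunLike.ext _ _ hab)

/-- The translate of an element of `E`. -/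
noncomputable def translFun (x : EuclideanSpace ℝ (Fin d)) (e : E) : E :=
  Set.mem_range.1 (h.translate_mem x e) |>.choose

theorem toDistr_translFun (x : EuclideanSpace ℝ (Fin d)) (e : E) :
    h.toDistr (h.translFun x e) = Distr.translate x (h.toDistr e) :=
  Set.mem_range.1 (h.translate_mem x e) |>.choose_spec

/-- Translation as a linear map on `E`. -/
noncomputable def translLM (x : EuclideanSpace ℝ (Fin d)) : E →ₗ[𝕜] E where
  toFun := h.translFun x
  map_add' a b := h.injective_toDistr (by simp only [map_add, toDistr_translFun])
  map_smul' c a := h.injective_toDistr (by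
    simp only [RingHom.id_apply, map_smul, toDistr_translFun, Distr.translate_smul])

/-- Translation as a continuous linear map on `E`. -/
noncomputable def transl (x : EuclideanSpace ℝ (Fin d)) : E →L[𝕜] E :=
  -- The graph is closed because translation is continuous on the Hausdorff space of distributions,
  -- into which `E` embeds continuously.
  ⟨h.translLM x, (h.translLM x).continuous_of_seq_closed_graph fun u e e' hu hu' => by
    refine h.injective_toDistr ?_
    have h1 := (h.toDistr.continuous.tendsto e').comp hu'
    have h2 := (((Distr.translate x).continuous.comp h.toDistr.continuous).tendsto e).comp hu
    change _ = h.toDistr (h.translFun x e)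
    rw [toDistr_translFun]
    refine tendsto_nhds_unique h1 (h2.congr fun n => ?_)
    exact (h.toDistr_translFun x (u n)).symm⟩

theorem toDistr_transl (x : EuclideanSpace ℝ (Fin d)) (e : E) :
    h.toDistr (h.transl x e) = Distr.translate x (h.toDistr e) :=
  h.toDistr_translFun x e

theorem pairing_transl (x : EuclideanSpace ℝ (Fin d)) (e : E) (φ : TestFn d ℝ) :
    h.pairing φ (h.transl x e) = h.pairing (TestFn.shift x φ) e := by
  rw [pairing_apply, toDistr_transl]; rfl

theorem transl_zero (e : E) : h.transl 0 e = e :=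
  h.eq_of_pairing_eq fun φ => by
    rw [pairing_transl]
    exact congrArg (fun ψ => h.pairing ψ e) (TestFn.shiftBy_zero (𝕜 := ℝ) φ)

theorem transl_add (x y : EuclideanSpace ℝ (Fin d)) (e : E) :
    h.transl (x + y) e = h.transl x (h.transl y e) :=
  h.eq_of_pairing_eq fun φ => by
    rw [pairing_transl, pairing_transl, pairing_transl, add_comm]
    exact congrArg (fun ψ => h.pairing ψ e) (TestFn.shiftBy_add (𝕜 := ℝ) y x φ)

theorem transl_ofTestFn (x : EuclideanSpace ℝ (Fin d)) (φ : TestFn d 𝕜) :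
    h.transl x (h.ofTestFn φ) = h.ofTestFn (TestFn.shiftBy (-x) φ) :=
  h.eq_of_pairing_eq fun ψ => by
    rw [pairing_transl, pairing_apply, pairing_apply, h.toDistr_ofTestFn, h.toDistr_ofTestFn]
    rw [← MeasureTheory.integral_sub_right_eq_self
      (fun y => ψ y • TestFn.shiftBy (-x) φ y) x]
    refine MeasureTheory.integral_congr_ae (Eventually.of_forall fun y => ?_)
    have h1 : TestFn.shift x ψ y = ψ (y - x) := rfl
    simp only [h1, TestFn.shiftBy_apply, sub_neg_eq_add, sub_add_cancel]

theorem continuous_transl_ofTestFn (φ : TestFn d 𝕜) :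
    Continuous fun x => h.transl x (h.ofTestFn φ) := by
  simp only [transl_ofTestFn]
  exact h.ofTestFn.continuous.comp ((TestFn.continuous_shiftBy φ).comp continuous_neg)

/-- Baire's theorem. The sets `A n` test only on test functions, whose orbits are already known to
be continuous; this makes `A n` closed, and density still yields the operator bound. A ball about
`x₀` is moved to `0` by composing with `h.transl (-x₀)`. -/
theorem exists_norm_transl_le_of_norm_lt :
    ∃ r > (0 : ℝ), ∃ M : ℝ, ∀ x, ‖x‖ < r → ‖h.transl x‖ ≤ M := by
  let A : ℕ → Set (EuclideanSpace ℝ (Fin d)) := fun n =>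
    {x | ∀ φ, ‖h.transl x (h.ofTestFn φ)‖ ≤ n * ‖h.ofTestFn φ‖}
  have hclosed : ∀ n, IsClosed (A n) := fun n => by
    simp only [A, Set.ofPred_forall]
    exact isClosed_iInter fun φ =>
      isClosed_le (h.continuous_transl_ofTestFn φ).norm continuous_const
  have hunion : ⋃ n, A n = Set.univ := Set.eq_univ_of_forall fun x => by
    obtain ⟨n, hn⟩ := exists_nat_ge ‖h.transl x‖
    exact Set.mem_iUnion.2 ⟨n, fun φ => (h.transl x).le_of_opNorm_le hn _⟩
  have hA : ∀ n, ∀ x ∈ A n, ‖h.transl x‖ ≤ n := fun n x hx =>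
    ContinuousLinearMap.opNorm_le_bound _ n.cast_nonneg fun e =>
      h.denseRange_ofTestFn.induction_on (p := fun e => ‖h.transl x e‖ ≤ n * ‖e‖) e
        (isClosed_le (h.transl x).continuous.norm (continuous_const.mul continuous_norm)) hx
  obtain ⟨n, x₀, hx₀⟩ := nonempty_interior_of_iUnion_of_closed hclosed hunion
  obtain ⟨r, hr, hball⟩ := Metric.isOpen_iff.1 isOpen_interior x₀ hx₀
  refine ⟨r, hr, ‖h.transl (-x₀)‖ * n, fun y hy => ?_⟩
  have h1 : x₀ + y ∈ A n := interior_subset (hball (by simpa [dist_eq_norm] using hy))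
  have h2 : h.transl y = (h.transl (-x₀)).comp (h.transl (x₀ + y)) := by
    ext e
    rw [ContinuousLinearMap.comp_apply, ← transl_add, neg_add_cancel_left]
  rw [h2]
  exact (ContinuousLinearMap.opNorm_comp_le _ _).trans
    (mul_le_mul_of_nonneg_left (hA n _ h1) (norm_nonneg _))

/-- The translation group is strongly continuous. -/
theorem continuous_transl (e : E) : Continuous fun x => h.transl x e := by
  obtain ⟨r, hr, M, hM⟩ := h.exists_norm_transl_le_of_norm_lt
  have hM0 : 0 ≤ M := (norm_nonneg _).trans (hM 0 (by simpa using hr))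
  have h0 : ∀ e, Tendsto (fun x => h.transl x e) (𝓝 0) (𝓝 e) := by
    intro e
    rw [Metric.tendsto_nhds]
    intro ε hε
    obtain ⟨φ, hφ⟩ := h.denseRange_ofTestFn.exists_dist_lt e
      (show 0 < ε / (2 * (M + 1)) by positivity)
    have h1 := (h.continuous_transl_ofTestFn φ).tendsto 0
    rw [transl_zero] at h1
    filter_upwards [Metric.tendsto_nhds.1 h1 (ε / 2) (half_pos hε),
      Metric.ball_mem_nhds (0 : EuclideanSpace ℝ (Fin d)) hr] with x hx hxr
    have h2 : dist (h.transl x e) (h.transl x (h.ofTestFn φ)) ≤ M * dist e (h.ofTestFn φ) := by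
      rw [dist_eq_norm, dist_eq_norm, ← map_sub]
      exact (h.transl x).le_of_opNorm_le (hM x (by simpa using hxr)) _
    have h3 : dist e (h.ofTestFn φ) * (2 * (M + 1)) < ε := (lt_div_iff₀ (by positivity)).1 hφ
    have h4 := dist_triangle4 (h.transl x e) (h.transl x (h.ofTestFn φ)) (h.ofTestFn φ) e
    rw [dist_comm (h.ofTestFn φ) e] at h4
    linarith
  rw [continuous_iff_continuousAt]
  intro x₀
  have h1 : Tendsto (fun x => x - x₀) (𝓝 x₀) (𝓝 0) := by
    have : Continuous fun x : EuclideanSpace ℝ (Fin d) => x - x₀ := by fun_prop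
    simpa using this.tendsto x₀
  refine ((h0 (h.transl x₀ e)).comp h1).congr fun x => ?_
  rw [Function.comp_apply, ← transl_add, sub_add_cancel]

theorem exists_norm_transl_le : ∃ M : ℝ, 1 ≤ M ∧ ∀ x, ‖x‖ ≤ 1 → ‖h.transl x‖ ≤ M := by
  obtain ⟨M, hM⟩ := banach_steinhaus
    (g := fun x : Metric.closedBall (0 : EuclideanSpace ℝ (Fin d)) 1 => h.transl x) (fun e => by
      obtain ⟨C, hC⟩ := (isCompact_closedBall (0 : EuclideanSpace ℝ (Fin d)) 1)
        |>.exists_bound_of_continuousOn (h.continuous_transl e).continuousOn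
      exact ⟨C, fun x => hC x x.2⟩)
  exact ⟨max 1 M, le_max_left _ _, fun x hx =>
    (hM ⟨x, by simpa using hx⟩).trans (le_max_right _ _)⟩

theorem continuous_transl_smul (v : EuclideanSpace ℝ (Fin d)) (e : E) :
    Continuous fun s : ℝ => h.transl (s • v) e :=
  (h.continuous_transl e).comp (continuous_id.smul continuous_const)

section Integral

variable [NormedSpace ℝ E]

theorem pairing_intervalIntegral_transl (v : EuclideanSpace ℝ (Fin d)) (e : E) (φ : TestFn d ℝ)
    (t : ℝ) : h.pairing φ (∫ s in (0 : ℝ)..t, h.transl (s • v) e) =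
      ∫ s in (0 : ℝ)..t, h.pairing (TestFn.shift (s • v) φ) e := by
  rw [← ContinuousLinearMap.intervalIntegral_comp_comm _
    ((h.continuous_transl_smul v e).intervalIntegrable 0 t)]
  simp only [pairing_transl]

/-- The fundamental theorem of calculus along the translation group. -/
theorem intervalIntegral_transl_of_lineDeriv {v : EuclideanSpace ℝ (Fin d)} {e e' : E}
    (he : h.toDistr e' = Distribution.lineDerivCLM v (h.toDistr e)) (t : ℝ) :
    ∫ s in (0 : ℝ)..t, h.transl (s • v) e' = h.transl (t • v) e - e := by
  refine h.eq_of_pairing_eq fun φ => ?_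
  have hderiv : ∀ s ∈ Set.uIcc 0 t, HasDerivAt (fun s : ℝ => h.pairing (TestFn.shift (s • v) φ) e)
      (h.pairing (TestFn.shift (s • v) φ) e') s := by
    intro s _
    rw [pairing_apply, he]
    exact TestFn.hasDerivAt_distr_shift (h.toDistr e) φ v s
  have hcont : Continuous fun s : ℝ => h.pairing (TestFn.shift (s • v) φ) e' := by
    simp only [← pairing_transl]
    exact (h.pairing φ).continuous.comp (h.continuous_transl_smul v e')
  rw [pairing_intervalIntegral_transl,
    intervalIntegral.integral_eq_sub_of_hasDerivAt hderiv (hcont.intervalIntegrable 0 t),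
    ← pairing_transl, ← pairing_transl, zero_smul, transl_zero, map_sub]

end Integral

/-- Averaging over a short segment of translations: it commutes with derivatives, is close to the
identity on differentiable elements, and gains one derivative. -/
theorem exists_average {M : ℝ} (hM : ∀ x, ‖x‖ ≤ 1 → ‖h.transl x‖ ≤ M)
    {v : EuclideanSpace ℝ (Fin d)} (hv : ‖v‖ ≤ 1) {δ : ℝ} (hδ : 0 < δ) (hδ1 : δ ≤ 1) :
    ∃ S : E →ₗ[𝕜] E, (∀ e, ‖S e‖ ≤ M * ‖e‖) ∧
      (∀ D ∈ Distr.translationInvariantOps d 𝕜, ∀ e e', h.toDistr e' = D (h.toDistr e) →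
        h.toDistr (S e') = D (h.toDistr (S e))) ∧
      ∀ e e', h.toDistr e' = Distribution.lineDerivCLM v (h.toDistr e) →
        ‖S e - e‖ ≤ M * δ * ‖e'‖ ∧ ‖S e'‖ ≤ (M + 1) / δ * ‖e‖ := by
  let _ : NormedSpace ℝ E := NormedSpace.restrictScalars ℝ 𝕜 E
  have _ : IsScalarTower ℝ 𝕜 E := IsScalarTower.restrictScalars ℝ 𝕜 E
  have hM0 : 0 ≤ M := (norm_nonneg _).trans (hM 0 (by simp))
  have hint : ∀ (e : E) (a b : ℝ), IntervalIntegrable (fun s : ℝ => h.transl (s • v) e)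
      MeasureTheory.volume a b := fun e a b => (h.continuous_transl_smul v e).intervalIntegrable a b
  have hT : ∀ s ∈ Set.Icc (0 : ℝ) δ, ∀ e, ‖h.transl (s • v) e‖ ≤ M * ‖e‖ := by
    intro s hs e
    refine (h.transl (s • v)).le_of_opNorm_le (hM _ ?_) e
    rw [norm_smul, Real.norm_of_nonneg hs.1]
    exact mul_le_one₀ (hs.2.trans hδ1) (norm_nonneg _) hv
  have hI : ∀ (t : ℝ), 0 ≤ t → t ≤ δ → ∀ e,
      ‖∫ s in (0 : ℝ)..t, h.transl (s • v) e‖ ≤ M * ‖e‖ * t := by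
    intro t ht0 ht e
    have := intervalIntegral.norm_integral_le_of_norm_le_const (a := 0) (b := t)
      (f := fun s : ℝ => h.transl (s • v) e) (C := M * ‖e‖) (fun s hs => by
        rw [Set.uIoc_of_le ht0] at hs
        exact hT s ⟨hs.1.le, hs.2.trans ht⟩ e)
    rwa [sub_zero, abs_of_nonneg ht0] at this
  let S : E →ₗ[𝕜] E :=
    { toFun := fun e => δ⁻¹ • ∫ s in (0 : ℝ)..δ, h.transl (s • v) e
      map_add' := fun a b => by
        simp only [map_add]
        rw [intervalIntegral.integral_add (hint a 0 δ) (hint b 0 δ), smul_add]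
      map_smul' := fun c a => by
        simp only [map_smul, RingHom.id_apply]
        rw [intervalIntegral.integral_smul, smul_comm] }
  have hS : ∀ e, S e = δ⁻¹ • ∫ s in (0 : ℝ)..δ, h.transl (s • v) e := fun e => rfl
  have hnorm : ∀ e : E, ‖δ⁻¹ • e‖ = δ⁻¹ * ‖e‖ := fun e => by
    rw [norm_smul, norm_inv, Real.norm_of_nonneg hδ.le]
  refine ⟨S, fun e => ?_, fun D hD e e' he => ?_, fun e e' he => ⟨?_, ?_⟩⟩
  · rw [hS, hnorm, inv_mul_le_iff₀ hδ, mul_comm δ]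
    exact hI δ hδ.le le_rfl e
  -- Paired with a test function, `D` becomes its transpose `P`, which commutes with the shifts
  -- under the integral.
  · obtain ⟨P, hP, hPshift⟩ := hD
    have hpair : ∀ φ a, h.pairing φ (S a) =
        δ⁻¹ • ∫ s in (0 : ℝ)..δ, h.pairing (TestFn.shift (s • v) φ) a := fun φ a => by
      rw [← pairing_intervalIntegral_transl, hS]
      exact map_smul ((h.pairing φ).restrictScalars ℝ) _ _
    ext φ
    rw [hP, ← pairing_apply, ← pairing_apply, hpair, hpair]
    congr 1
    refine intervalIntegral.integral_congr fun s _ => ?_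
    change h.toDistr e' _ = h.toDistr e _
    rw [he, hP, hPshift]
  -- The integrand is `T_{sv} e - e = ∫₀^s T_{rv} e' dr`, of norm at most `M δ ‖e'‖`.
  · have h1 : S e - e = δ⁻¹ • ∫ s in (0 : ℝ)..δ, (h.transl (s • v) e - e) := by
      rw [intervalIntegral.integral_sub (hint e 0 δ) intervalIntegrable_const,
        intervalIntegral.integral_const, sub_zero, smul_sub, inv_smul_smul₀ hδ.ne', hS]
    rw [h1, hnorm, inv_mul_le_iff₀ hδ]
    have := intervalIntegral.norm_integral_le_of_norm_le_const (a := 0) (b := δ)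
      (f := fun s : ℝ => h.transl (s • v) e - e) (C := M * ‖e'‖ * δ) (fun s hs => by
        rw [Set.uIoc_of_le hδ.le] at hs
        rw [← h.intervalIntegral_transl_of_lineDeriv he]
        exact (hI s hs.1.le hs.2 e').trans (by gcongr; exact hs.2))
    rw [sub_zero, abs_of_nonneg hδ.le] at this
    exact this.trans (le_of_eq (by ring))
  · rw [hS, h.intervalIntegral_transl_of_lineDeriv he, hnorm, div_mul_eq_mul_div,
      inv_mul_le_iff₀ hδ, mul_div_cancel₀ _ hδ.ne']
    have := hT δ ⟨hδ.le, le_rfl⟩ e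
    calc ‖h.transl (δ • v) e - e‖ ≤ ‖h.transl (δ • v) e‖ + ‖e‖ := norm_sub_le _ _
      _ ≤ (M + 1) * ‖e‖ := by linarith

end TIBD

/-! ### Completeness of `𝒟_E` and approximation by iterated averages -/

namespace TIBD

variable {d : ℕ} {𝕜 : Type*} [RCLike 𝕜] {E : Type*} [NormedAddCommGroup E]
  [NormedSpace 𝕜 E] [CompleteSpace E] (h : TIBD d 𝕜 E)

theorem toDistr_deriv (α : Fin d → ℕ) (e : h.DE) :
    h.toDistr (h.deriv α e) = Distr.partialDeriv α (h.toDistr (h.incl e)) :=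
  h.toDistr_derivFun α e

theorem deriv_eq_of_toDistr_eq {α : Fin d → ℕ} {e : h.DE} {e' : E}
    (he : h.toDistr e' = Distr.partialDeriv α (h.toDistr (h.incl e))) : h.deriv α e = e' :=
  h.injective_toDistr (by rw [toDistr_deriv, he])

theorem deriv_zero (e : h.DE) : h.deriv 0 e = h.incl e :=
  h.deriv_eq_of_toDistr_eq (by rw [Distr.partialDeriv_zero])

theorem toDistr_deriv_add_single (α : Fin d → ℕ) (j : Fin d) (e : h.DE) :
    h.toDistr (h.deriv (α + Pi.single j 1) e) =
      Distribution.lineDerivCLM (EuclideanSpace.single j (1 : ℝ)) (h.toDistr (h.deriv α e)) := by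
  rw [toDistr_deriv, toDistr_deriv, Distr.partialDeriv_add_single]

theorem incl_injective : Function.Injective h.incl := Subtype.val_injective

/-- The element of `𝒟_E` with prescribed derivatives in `E`. -/
def mkDE (e : E) (D : (Fin d → ℕ) → E)
    (hD : ∀ α, h.toDistr (D α) = Distr.partialDeriv α (h.toDistr e)) : h.DE :=
  ⟨e, fun α => ⟨D α, hD α⟩⟩

theorem deriv_mkDE {e : E} {D : (Fin d → ℕ) → E}
    (hD : ∀ α, h.toDistr (D α) = Distr.partialDeriv α (h.toDistr e)) (α : Fin d → ℕ) :
    h.deriv α (h.mkDE e D hD) = D α :=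
  h.deriv_eq_of_toDistr_eq (hD α)

theorem norms_le_iff {n : ℕ} {e : h.DE} {a : ℝ} (ha : 0 ≤ a) :
    h.norms n e ≤ a ↔ ∀ α : Fin d → ℕ, ∑ i, α i ≤ n → ‖h.deriv α e‖ ≤ a := by
  unfold norms
  refine ⟨fun H α hα => (Seminorm.le_finset_sup_apply
    (p := fun α => (normSeminorm 𝕜 E).comp (h.deriv α)) ?_).trans H,
    fun H => Seminorm.finset_sup_apply_le ha fun α hα => H α (Finset.mem_filter.1 hα).2⟩
  refine Finset.mem_filter.2 ⟨Finset.mem_Iic.2 fun i => ?_, hα⟩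
  exact (Finset.single_le_sum (f := α) (fun _ _ => Nat.zero_le _) (Finset.mem_univ i)).trans hα

theorem norm_deriv_le_norms {n : ℕ} {α : Fin d → ℕ} (hα : ∑ i, α i ≤ n) (e : h.DE) :
    ‖h.deriv α e‖ ≤ h.norms n e :=
  (h.norms_le_iff (apply_nonneg _ _)).1 le_rfl α hα

theorem monotone_norms : Monotone h.norms := fun _ _ hmn e =>
  (h.norms_le_iff (apply_nonneg _ _)).2 fun _ hα => h.norm_deriv_le_norms (hα.trans hmn) e

theorem isFrechetSpace_DE : IsFrechetSpace 𝕜 h.DE := by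
  refine ⟨?_, ⟨h.norms, h.withSeminorms_norms⟩, fun u hu => ?_⟩
  · have := h.withSeminorms_norms.T1_of_separating fun e he => by
      refine ⟨0, fun h0 => he (h.incl_injective ?_)⟩
      rw [map_zero, ← norm_le_zero_iff, ← deriv_zero, ← h0]
      exact h.norm_deriv_le_norms (by simp) e
    infer_instance
  · have hcauchy : ∀ α, CauchySeq fun j => h.deriv α (u j) := by
      intro α
      rw [Metric.cauchySeq_iff]
      intro ε hε
      rw [h.withSeminorms_norms.tendsto_nhds] at hu
      obtain ⟨⟨a, b⟩, hN⟩ := eventually_atTop.1 (hu (∑ i, α i) ε hε)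
      refine ⟨max a b, fun m hm n hn => ?_⟩
      have := hN (m, n) ⟨le_of_max_le_left hm, le_of_max_le_right hn⟩
      rw [sub_zero] at this
      rw [dist_eq_norm, ← map_sub]
      exact (h.norm_deriv_le_norms le_rfl _).trans_lt this
    choose D hD using fun α => cauchySeq_tendsto_of_complete (hcauchy α)
    -- The limits of the derivatives are the derivatives of the limit, since `∂^α` is continuous on
    -- distributions.
    have hD' : ∀ α, h.toDistr (D α) = Distr.partialDeriv α (h.toDistr (D 0)) := by
      intro α
      have h1 := (h.toDistr.continuous.tendsto _).comp (hD α)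
      have h2 := (((Distr.partialDeriv α).continuous.comp h.toDistr.continuous).tendsto _).comp
        (hD 0)
      refine tendsto_nhds_unique h1 (h2.congr fun j => ?_)
      simp only [Function.comp_apply, toDistr_deriv, Distr.partialDeriv_zero]
    refine ⟨h.mkDE (D 0) D hD', ?_⟩
    rw [h.withSeminorms_norms.tendsto_nhds]
    intro n ε hε
    have hall : ∀ᶠ j in atTop, ∀ α ∈ Finset.Iic (fun _ : Fin d => n),
        ‖h.deriv α (u j) - D α‖ < ε / 2 := by
      rw [Filter.eventually_all_finset]
      intro α _
      have := Metric.tendsto_nhds.1 (hD α) (ε / 2) (half_pos hε)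
      simpa only [dist_eq_norm] using this
    filter_upwards [hall] with j hj
    refine lt_of_le_of_lt ((h.norms_le_iff (half_pos hε).le).2 fun α hα => ?_) (half_lt_self hε)
    rw [map_sub, deriv_mkDE]
    refine (hj α (Finset.mem_Iic.2 fun i => ?_)).le
    exact (Finset.single_le_sum (f := α) (fun _ _ => Nat.zero_le _) (Finset.mem_univ i)).trans hα

/-- Iterated averages in the coordinate directions listed in `w`. -/
theorem exists_iterated_average {M : ℝ} (hM1 : 1 ≤ M) (hM : ∀ x, ‖x‖ ≤ 1 → ‖h.transl x‖ ≤ M)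
    {δ : ℝ} (hδ : 0 < δ) (hδ1 : δ ≤ 1) (w : List (Fin d)) (x : h.DE) :
    ∃ y : h.DE,
      (∀ α : Fin d → ℕ, ‖h.deriv α y‖ ≤
        ((M + 1) / δ) ^ w.length * ‖h.deriv (α - fun i => w.count i) x‖) ∧
      ∀ (β : Fin d → ℕ) (N : ℝ), (∀ j, ‖h.deriv (β + Pi.single j 1) x‖ ≤ N) → 0 ≤ N →
        ‖h.deriv β (x - y)‖ ≤ (2 * M) ^ w.length * δ * N := by
  induction w with
  | nil =>
    refine ⟨x, fun α => ?_, fun β N _ hN => ?_⟩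
    · have : (α - fun i => List.count i ([] : List (Fin d))) = α := by ext i; simp
      rw [this, List.length_nil, pow_zero, one_mul]
    · rw [sub_self, map_zero, norm_zero]
      positivity
  | cons i w ih =>
    obtain ⟨y, hy, hxy⟩ := ih
    obtain ⟨S, hSM, hSD, hSv⟩ := h.exists_average hM
      (v := EuclideanSpace.single i (1 : ℝ)) (by simp) hδ hδ1
    have hS : ∀ (e : h.DE) (α : Fin d → ℕ),
        h.toDistr (S (h.deriv α e)) = Distr.partialDeriv α (h.toDistr (S (h.incl e))) :=
      fun e α => hSD _ (Distr.partialDeriv_mem_translationInvariantOps α) _ _ (h.toDistr_deriv α e)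
    let z : h.DE := h.mkDE (S (h.incl y)) (fun α => S (h.deriv α y)) (hS y)
    have hz : ∀ α, h.deriv α z = S (h.deriv α y) := fun α => h.deriv_mkDE (hS y) α
    have hMδ : M ≤ (M + 1) / δ := by
      rw [le_div_iff₀ hδ]
      calc M * δ ≤ M * 1 := by gcongr
        _ ≤ M + 1 := by linarith
    have hMδ0 : 0 ≤ (M + 1) / δ := by positivity
    refine ⟨z, fun α => ?_, fun β N hN hN0 => ?_⟩
    · rw [hz, List.length_cons, pow_succ', mul_assoc]
      -- If `α` contains a `∂_i`, the average absorbs it. Otherwise truncated subtraction leaves `α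
      -- i = 0`, and the plain bound `M ≤ (M + 1) / δ` suffices.
      rcases Nat.eq_zero_or_pos (α i) with hi | hi
      · have h1 : (α - fun j => (i :: w).count j) = α - fun j => w.count j := by
          ext j
          by_cases hji : j = i
          · subst hji; simp [hi]
          · simp [List.count_cons_of_ne (Ne.symm hji)]
        rw [h1]
        exact (hSM _).trans (mul_le_mul hMδ (hy α) (norm_nonneg _) hMδ0)
      · obtain ⟨α', rfl⟩ : ∃ α' : Fin d → ℕ, α = α' + Pi.single i 1 := by
          refine ⟨α - Pi.single i 1, ?_⟩
          ext j
          by_cases hji : j = i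
          · subst hji; simp; omega
          · simp [Pi.single_eq_of_ne hji]
        have h1 : (α' + Pi.single i 1 - fun j => (i :: w).count j) = α' - fun j => w.count j := by
          ext j
          by_cases hji : j = i
          · subst hji; simp
          · simp [Pi.single_eq_of_ne hji, List.count_cons_of_ne (Ne.symm hji)]
        rw [h1]
        exact (hSv _ _ (h.toDistr_deriv_add_single α' i y)).2.trans
          (mul_le_mul_of_nonneg_left (hy α') hMδ0)
    -- The old error is multiplied by at most `M` and the new one is no larger than that bound,
    -- whence the factor `2 * M` per average.
    · have h1 : h.deriv β (x - z) =
          S (h.deriv β (x - y)) - (S (h.deriv β x) - h.deriv β x) := by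
        rw [map_sub, hz, map_sub, map_sub]; abel
      have h2 : ‖S (h.deriv β (x - y))‖ ≤ M * ((2 * M) ^ w.length * δ * N) :=
        (hSM _).trans (mul_le_mul_of_nonneg_left (hxy β N hN hN0) (by linarith))
      have h3 : ‖S (h.deriv β x) - h.deriv β x‖ ≤ M * δ * N :=
        (hSv _ _ (h.toDistr_deriv_add_single β i x)).1.trans
          (mul_le_mul_of_nonneg_left (hN i) (by positivity))
      have h4 : (1 : ℝ) ≤ (2 * M) ^ w.length := one_le_pow₀ (by linarith)
      have h5 : M * δ * N ≤ M * ((2 * M) ^ w.length * δ * N) := by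
        have : 0 ≤ M * δ * N := by positivity
        calc M * δ * N ≤ (2 * M) ^ w.length * (M * δ * N) := le_mul_of_one_le_left this h4
          _ = _ := by ring
      rw [h1, List.length_cons, pow_succ]
      refine (norm_sub_le _ _).trans ?_
      calc _ ≤ M * ((2 * M) ^ w.length * δ * N) + M * ((2 * M) ^ w.length * δ * N) :=
            add_le_add h2 (h3.trans h5)
        _ = _ := by ring

theorem exists_list_le_count (d k : ℕ) : ∃ w : List (Fin d), ∀ i, k ≤ w.count i := by
  induction k with
  | zero => exact ⟨[], fun i => Nat.zero_le _⟩
  | succ k ih =>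
    obtain ⟨w, hw⟩ := ih
    refine ⟨List.finRange d ++ w, fun i => ?_⟩
    rw [List.count_append]
    have : 0 < (List.finRange d).count i := List.count_pos_iff.2 (List.mem_finRange i)
    have := hw i
    omega

theorem exists_approx (n k : ℕ) : ∃ C > (0 : ℝ), ∃ s > (0 : ℝ), ∀ ε > (0 : ℝ), ε ≤ 1 →
    ∀ x : h.DE, ∃ y, h.norms n (x - y) ≤ ε * h.norms (n + 1) x ∧
      h.norms k y ≤ C / ε ^ s * h.norms (n + 1) x := by
  obtain ⟨M, hM1, hM⟩ := h.exists_norm_transl_le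
  obtain ⟨w, hw⟩ := exists_list_le_count d k
  set l := w.length with hl
  have hK1 : (1 : ℝ) ≤ (2 * M) ^ l := one_le_pow₀ (by linarith)
  have hK : (0 : ℝ) < (2 * M) ^ l := by linarith
  -- With `δ = ε / (2M)^l` the error is exactly `ε` times the norm. The exponent is `l + 1` because
  -- `s` must be positive and `l` may be `0`; raising it is harmless as the base is at least `1` for
  -- `ε ≤ 1`.
  refine ⟨((M + 1) * (2 * M) ^ l) ^ (l + 1), by positivity, ((l + 1 : ℕ) : ℝ), by positivity,
    fun ε hε hε1 x => ?_⟩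
  have hδ : 0 < ε / (2 * M) ^ l := by positivity
  have hδ1 : ε / (2 * M) ^ l ≤ 1 := (div_le_one hK).2 (hε1.trans hK1)
  obtain ⟨y, hy, hxy⟩ := h.exists_iterated_average hM1 hM hδ hδ1 w x
  have hN : 0 ≤ h.norms (n + 1) x := apply_nonneg _ _
  refine ⟨y, (h.norms_le_iff (by positivity)).2 fun β hβ => ?_,
    (h.norms_le_iff (by positivity)).2 fun α hα => ?_⟩
  · have := hxy β (h.norms (n + 1) x) (fun j => h.norm_deriv_le_norms (by
      simp only [Pi.add_apply, Finset.sum_add_distrib, Finset.sum_pi_single', Finset.mem_univ,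
        if_true]
      simpa using hβ) x) hN
    rwa [← hl, mul_div_cancel₀ _ hK.ne'] at this
  -- Every direction occurs at least `k` times in `w`, so all derivatives of order at most `k` are
  -- absorbed.
  · have h0 : (α - fun i => w.count i) = 0 := by
      ext i
      have h1 := (Finset.single_le_sum (f := α) (fun _ _ => Nat.zero_le _)
        (Finset.mem_univ i)).trans hα
      have h2 := hw i
      simp only [Pi.sub_apply, Pi.zero_apply]
      omega
    have h1 := hy α
    rw [h0] at h1
    have h2 : (M + 1) / (ε / (2 * M) ^ l) = (M + 1) * (2 * M) ^ l / ε := by field_simp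
    have h3 : 1 ≤ (M + 1) * (2 * M) ^ l / ε := by
      rw [one_le_div hε]
      calc ε ≤ 1 * 1 := by linarith
        _ ≤ (M + 1) * (2 * M) ^ l := by gcongr; linarith
    rw [Real.rpow_natCast, ← div_pow]
    rw [← hl, h2] at h1
    refine h1.trans (mul_le_mul (pow_le_pow_right₀ h3 (Nat.le_succ l))
      (h.norm_deriv_le_norms (by simp) x) (norm_nonneg _) (by positivity))

end TIBD

theorem theorem5p6 (d : ℕ) (𝕜 : Type*) [RCLike 𝕜] (E : Type*) [NormedAddCommGroup E]
    [NormedSpace 𝕜 E] [CompleteSpace E] (h : TIBD d 𝕜 E) :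
    IsFrechetSpace 𝕜 h.DE ∧ SatisfiesOmega 𝕜 h.DE ∧ IsQuasinormable 𝕜 h.DE ∧
      IsDistinguished 𝕜 h.DE := by
  have hp := h.withSeminorms_norms
  have hmono := h.monotone_norms
  have hF := h.isFrechetSpace_DE
  have Q : ∀ n, ∀ ε > (0 : ℝ), ∃ C : ℕ → ℝ, ∀ x, h.norms (n + 1) x ≤ 1 →
      ∃ b, h.norms n (x - b) ≤ ε ∧ ∀ k, h.norms k b ≤ C k := fun n ε hε =>
    exists_bounded_approx_of_approx hp hmono hF.2.2 (fun n k ε hε => by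
      obtain ⟨C, hC, s, hs, H⟩ := h.exists_approx n k
      -- The approximation is available only for accuracies at most `1`.
      have hpos : 0 < min ε 1 := lt_min hε one_pos
      refine ⟨C / min ε 1 ^ s, div_pos hC (Real.rpow_pos_of_pos hpos s), fun x => ?_⟩
      obtain ⟨y, hy, hy'⟩ := H (min ε 1) hpos (min_le_right _ _) x
      exact ⟨y, hy.trans (mul_le_mul_of_nonneg_right (min_le_left _ _) (apply_nonneg _ _)), hy'⟩)
      n hε
  exact ⟨hF, satisfiesOmega_of_approx hp hmono h.exists_approx,
    isQuasinormable_of_bounded_approx hp hmono Q, isDistinguished_of_bounded_approx hp hmono Q⟩
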